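/- Let $\mathcal H$ be a complex Hilbert space of finite dimension $d\ge 2$ and let $\mathcal B(\mathcal H)$ be the space of linear operators on $\mathcal H$. A \emph{semigroup} in $\mathcal B(\mathcal H)$ is a family $\{\Lambda_t\}_{t\ge 0}$ of linear maps $\Lambda_t\colon\mathcal B(\mathcal H)\to\mathcal B(\mathcal H)$ with $\Lambda_t\Lambda_s=\Lambda_{t+s}$ for $t,s\ge 0$, $\Lambda_0=\mathrm{Id}$ and $\lim_{t\downarrow 0}\Lambda_tA=A$ for every $A$. A locally compact group is understood to be second countable and Hausdorff; a representation is a homomorphism into the unitary group of $\mathcal H$. Let $\{\Lambda_t\}_{t\ge 0}$ be a family of linear maps $\mathcal B(\mathcal H)\to\mathcal B(\mathcal H)$. (1) $\{\Lambda_t\}$ is a semigroup of positive, trace-preserving, unital maps if and only if there are a locally compact group $G$, a continuous unitary representation $\pi$ of $G$ in $\mathcal H$ and a family $\{\sigma_t\}_{t\ge 0}$ of finite signed Borel measures on $G$ such that $$\Lambda_t(A)=\int_G \pi(g)A\pi(g)^*\,d\sigma_t(g)\qquad (t\ge 0,\ A\in\mathcal B(\mathcal H)) \qquad (*)$$ and,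 writing $v_{jklm}(g)=\langle\psi_j,\pi(g)\psi_k\rangle\langle\pi(g)\psi_l,\psi_m\rangle$ for an orthonormal basis $\{\psi_k\}_{k=1}^d$ of $\mathcal H$: (M1) $\sigma_0=\delta$ is the Dirac measure at the identity, and $\sigma_t(G)=1$ for every $t>0$; (M2) for some orthonormal basis $\{\psi_k\}$ and all $j,k,l,m$: $\lim_{t\downarrow 0}\int_G v_{jklm}\,d\sigma_t=\delta_{jk}\delta_{lm}$, and $\int_G v_{jklm}\,d(\sigma_s * \sigma_t)=\int_G v_{jklm}\,d\sigma_{s+t}$ for all $s,t>0$, where $*$ is convolution; (M3) for every orthonormal basis $\{\psi_k\}$ and all $j\ne k$, the limit $\lim_{t\downarrow 0}t^{-1}\int_G v_{jkkj}\,d\sigma_t$ exists and is $\ge 0$. (2) In (1) one can always take $G=SU(d)$ and for $\pi$ the defining representation, $U(d)$ being identified with the unitary group of $\mathcal H$ by means of any orthonormal basis. (3) For any continuous unitary representation $\pi$ in $\mathcal H$ of a locally compact group $G$ and any family $\{\sigma_t\}_{t\ge0}$ of finite signed Borel measures on $G$, if (M2) holds for some orthonormal basis, then it holds for every orthonormal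 basis. (4) Let $S$ be any one of the following functions of a density operator $\rho$ with eigenvalues $p_1,\dots,p_d$ (repeated according to multiplicity): the Tsallis entropy $\frac{1}{1-q}\big(\sum_k p_k^q-1\big)$ or the Rényi entropy $\frac1{1-q}\ln\sum_k p_k^q$ with $0<q\ne1$, the von Neumann entropy $-\sum_k p_k\ln p_k$ (the case $q=1$ of both), or $1-\|\rho\|_p$ with $1<p\le\infty$, where $\|\cdot\|_p$ is the Schatten $p$-norm ($\|\cdot\|_\infty$ is the operator norm). Suppose that $\{\Lambda_t\}$ is a semigroup of positive, trace-preserving maps. Then $\{\Lambda_t\}$ does not decrease $S$ --- that is, $S(\Lambda_{t+s}\rho)\ge S(\Lambda_t\rho)$ for all density operators $\rho$ and all $t,s\ge0$ --- if and only if it is of the form $(*)$ for some locally compact group $G$, some continuous unitary representation $\pi$ of $G$ in $\mathcal H$ and some family $\{\sigma_t\}_{t\ge0}$ of finite signed Borel measures on $G$; equivalently, if and only if it is of the form $(*)$ with (M1), (M2) and (M3) satisfied (a \emph{generalized twirling semigroup}). -/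

import Mathlib

open MeasureTheory Filter Topology
open scoped NNReal ENNReal

universe u v

noncomputable section

namespace GenTwirling

/-! ### Semigroups of linear maps on `B(H)` -/

section Maps

variable {H : Type*} [NormedAddCommGroup H] [InnerProductSpace ℂ H]

/-- The trace of an operator on `H`. -/
def opTrace (A : H →L[ℂ] H) : ℂ := LinearMap.trace ℂ H (A : H →ₗ[ℂ] H)

/-- A (continuous, one-parameter) semigroup of operators acting in `B(H)`. -/
structure IsOpSemigroup (Λ : ℝ≥0 → ((H →L[ℂ] H) →ₗ[ℂ] (H →L[ℂ] H))) : Prop where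
  comp : ∀ t s, Λ t ∘ₗ Λ s = Λ (t + s)
  zero : Λ 0 = LinearMap.id
  tendsto : ∀ A : H →L[ℂ] H, Tendsto (fun t : ℝ≥0 => Λ t A) (𝓝[>] 0) (𝓝 A)

/-- A positive linear map on `B(H)`: it sends positive operators to positive operators. -/
def IsPositiveMap (Φ : (H →L[ℂ] H) →ₗ[ℂ] (H →L[ℂ] H)) : Prop :=
  ∀ A : H →L[ℂ] H, A.IsPositive → (Φ A).IsPositive

/-- A trace-preserving linear map on `B(H)`. -/
def IsTracePreserving (Φ : (H →L[ℂ] H) →ₗ[ℂ] (H →L[ℂ] H)) : Prop :=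
  ∀ A : H →L[ℂ] H, opTrace (Φ A) = opTrace A

/-- A unital linear map on `B(H)`. -/
def IsUnital (Φ : (H →L[ℂ] H) →ₗ[ℂ] (H →L[ℂ] H)) : Prop :=
  Φ 1 = 1

/-- A (continuous) semigroup whose members are positive, trace-preserving linear maps. -/
structure IsPTPSemigroup (Λ : ℝ≥0 → ((H →L[ℂ] H) →ₗ[ℂ] (H →L[ℂ] H))) : Prop
    extends IsOpSemigroup Λ where
  positive : ∀ t, IsPositiveMap (Λ t)
  tracePreserving : ∀ t, IsTracePreserving (Λ t)

/-- A (continuous) semigroup whose members are positive, trace-preserving, unital linear maps. -/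
structure IsUnitalPTPSemigroup (Λ : ℝ≥0 → ((H →L[ℂ] H) →ₗ[ℂ] (H →L[ℂ] H))) : Prop
    extends IsPTPSemigroup Λ where
  unital : ∀ t, IsUnital (Λ t)

end Maps

/-! ### Density operators and entropies -/

section Entropy

variable {H : Type*} [NormedAddCommGroup H] [InnerProductSpace ℂ H] [CompleteSpace H]

variable (H) in
/-- The density operators on `H`: positive operators of unit trace. -/
structure DensityOp where
  op : H →L[ℂ] H
  isPositive : op.IsPositive
  trace_eq_one : opTrace op = 1

/-- The action of a positive, trace-preserving map on density operators. -/
def DensityOp.map (ρ : DensityOp H) (Φ : (H →L[ℂ] H) →ₗ[ℂ] (H →L[ℂ] H))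
    (hpos : IsPositiveMap Φ) (htr : IsTracePreserving Φ) : DensityOp H where
  op := Φ ρ.op
  isPositive := hpos _ ρ.isPositive
  trace_eq_one := (htr _).trans ρ.trace_eq_one

/-- The semigroup `Λ` does not decrease `E`: `E (Λ_{t+s} ρ) ≥ E (Λ_t ρ)` for every density
operator `ρ` and all `t, s ≥ 0`. -/
def DoesNotDecrease {Λ : ℝ≥0 → ((H →L[ℂ] H) →ₗ[ℂ] (H →L[ℂ] H))} (hΛ : IsPTPSemigroup Λ)
    (E : DensityOp H → ℝ) : Prop :=
  ∀ (ρ : DensityOp H) (t s : ℝ≥0),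
    E (ρ.map (Λ t) (hΛ.positive t) (hΛ.tracePreserving t)) ≤
      E (ρ.map (Λ (t + s)) (hΛ.positive (t + s)) (hΛ.tracePreserving (t + s)))

variable [FiniteDimensional ℂ H]

/-- The eigenvalues of a density operator, repeated according to multiplicity (and listed in
decreasing order). -/
def DensityOp.eigenvalues (ρ : DensityOp H) : Fin (Module.finrank ℂ H) → ℝ :=
  ρ.isPositive.isSymmetric.eigenvalues rfl

/-- The von Neumann entropy `- tr (ρ ln ρ)` (here `Real.log 0 = 0`, so that `0 ln 0 = 0`). -/
def vonNeumannEntropy (ρ : DensityOp H) : ℝ :=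
  -∑ k, ρ.eigenvalues k * Real.log (ρ.eigenvalues k)

/-- The Tsallis entropy `(tr (ρ ^ q) - 1) / (1 - q)`, equal to the von Neumann entropy for
`q = 1`. -/
def tsallisEntropy (q : ℝ) (ρ : DensityOp H) : ℝ :=
  if q = 1 then vonNeumannEntropy ρ
  else 1 / (1 - q) * ((∑ k, ρ.eigenvalues k ^ q) - 1)

/-- The Rényi entropy `ln (tr (ρ ^ q)) / (1 - q)`, equal to the von Neumann entropy for
`q = 1`. -/
def renyiEntropy (q : ℝ) (ρ : DensityOp H) : ℝ :=
  if q = 1 then vonNeumannEntropy ρ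
  else 1 / (1 - q) * Real.log (∑ k, ρ.eigenvalues k ^ q)

/-- The function `1 - ‖ρ‖_p`, where `‖·‖_p` is the Schatten `p`-norm: `‖ρ‖_∞` is the operator
norm, and `‖ρ‖_p = tr (|ρ| ^ p) ^ (1 / p)` for finite `p` (recall that `|ρ| = ρ`). -/
def schattenEntropy (p : ℝ≥0∞) (ρ : DensityOp H) : ℝ :=
  if p = ∞ then 1 - ‖ρ.op‖
  else 1 - (∑ k, ρ.eigenvalues k ^ p.toReal) ^ (1 / p.toReal)

/-- The quantum entropies under consideration: the Tsallis and the Rényi entropies of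
parameter `q > 0`, and the functions `1 - ‖·‖_p` for `1 < p ≤ ∞`. -/
inductive IsQuantumEntropy : (DensityOp H → ℝ) → Prop
  | tsallis (q : ℝ) (hq : 0 < q) : IsQuantumEntropy (tsallisEntropy q)
  | renyi (q : ℝ) (hq : 0 < q) : IsQuantumEntropy (renyiEntropy q)
  | schatten (p : ℝ≥0∞) (hp : 1 < p) : IsQuantumEntropy (schattenEntropy p)

end Entropy

/-! ### Signed measures on a group and unitary representations -/

section Twirling

variable {H : Type*} [NormedAddCommGroup H] [InnerProductSpace ℂ H] [CompleteSpace H]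
  {G : Type*} [Group G] [MeasurableSpace G]

/-- A signed measure has finite total variation; hence products of signed measures exist, and
bounded continuous functions on a second countable space are integrable. -/
instance instIsFiniteMeasureVariation {X : Type*} [MeasurableSpace X] (σ : SignedMeasure X) :
    IsFiniteMeasure σ.variation := by
  rw [← SignedMeasure.totalVariation_eq_variation]
  unfold SignedMeasure.totalVariation
  infer_instance

/-- The convolution of two finite signed measures: the image of the product measure under the
multiplication map. -/
def signedConv (σ τ : SignedMeasure G) : SignedMeasure G :=
  (VectorMeasure.prod σ τ (ContinuousLinearMap.lsmul ℝ ℝ)).map (fun p : G × G => p.1 * p.2)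

/-- `Λ_t A = ∫ π(g) A π(g)* dσ_t(g)`. -/
def IsTwirlingIntegral (Λ : ℝ≥0 → ((H →L[ℂ] H) →ₗ[ℂ] (H →L[ℂ] H)))
    (π : G →* unitary (H →L[ℂ] H)) (σ : ℝ≥0 → SignedMeasure G) : Prop :=
  ∀ (t : ℝ≥0) (A : H →L[ℂ] H),
    Λ t A = ∫ᵛ g, ((π g : H →L[ℂ] H) * A * star (π g : H →L[ℂ] H)) ∂<•(σ t)

/-- The function `v_{jklm}(g) = ⟨ψ_j, π(g) ψ_k⟩ ⟨π(g) ψ_l, ψ_m⟩`. -/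
def matrixCoeff {ι : Type*} [Fintype ι] (ψ : OrthonormalBasis ι ℂ H)
    (π : G →* unitary (H →L[ℂ] H)) (j k l m : ι) (g : G) : ℂ :=
  inner ℂ (ψ j) ((π g : H →L[ℂ] H) (ψ k)) * inner ℂ ((π g : H →L[ℂ] H) (ψ l)) (ψ m)

/-- `σ_0` is the Dirac measure at the identity and `σ_t(G) = 1` for `t > 0`. -/
def CondM1 (σ : ℝ≥0 → SignedMeasure G) : Prop :=
  σ 0 = VectorMeasure.dirac 1 1 ∧ ∀ t : ℝ≥0, 0 < t → σ t Set.univ = 1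

/-- With respect to a given orthonormal basis, `∫ v_{jklm} dσ_t → δ_{jk} δ_{lm}` as `t ↓ 0`, and
`∫ v_{jklm} d(σ_s * σ_t) = ∫ v_{jklm} dσ_{s+t}` for all `s, t > 0`. -/
def CondM2 {ι : Type*} [Fintype ι] [DecidableEq ι] (ψ : OrthonormalBasis ι ℂ H)
    (π : G →* unitary (H →L[ℂ] H)) (σ : ℝ≥0 → SignedMeasure G) : Prop :=
  (∀ j k l m : ι,
    Tendsto (fun t : ℝ≥0 => ∫ᵛ g, matrixCoeff ψ π j k l m g ∂<•(σ t)) (𝓝[>] 0)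
      (𝓝 ((if j = k then 1 else 0) * (if l = m then 1 else 0)))) ∧
  (∀ (j k l m : ι) (s t : ℝ≥0), 0 < s → 0 < t →
    ∫ᵛ g, matrixCoeff ψ π j k l m g ∂<•(signedConv (σ s) (σ t)) =
      ∫ᵛ g, matrixCoeff ψ π j k l m g ∂<•(σ (s + t)))

/-- With respect to a given orthonormal basis, for `j ≠ k` the limit of `t⁻¹ ∫ v_{jkkj} dσ_t` as
`t ↓ 0` exists and is a non-negative real number. -/
def CondM3 {ι : Type*} [Fintype ι] (ψ : OrthonormalBasis ι ℂ H)
    (π : G →* unitary (H →L[ℂ] H)) (σ : ℝ≥0 → SignedMeasure G) : Prop :=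
  ∀ j k : ι, j ≠ k → ∃ L : ℝ, 0 ≤ L ∧
    Tendsto (fun t : ℝ≥0 => ((t : ℝ) : ℂ)⁻¹ * ∫ᵛ g, matrixCoeff ψ π j k k j g ∂<•(σ t))
      (𝓝[>] 0) (𝓝 (L : ℂ))

/-- The conditions `CondM1`, `CondM2` (for some orthonormal basis) and `CondM3` (for every
orthonormal basis) on a pair `(π, σ)`. -/
structure IsTwirlingPair (π : G →* unitary (H →L[ℂ] H)) (σ : ℝ≥0 → SignedMeasure G) : Prop where
  m1 : CondM1 σ
  m2 : ∃ ψ : OrthonormalBasis (Fin (Module.finrank ℂ H)) ℂ H, CondM2 ψ π σ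
  m3 : ∀ ψ : OrthonormalBasis (Fin (Module.finrank ℂ H)) ℂ H, CondM3 ψ π σ

end Twirling

section Forms

variable {H : Type*} [NormedAddCommGroup H] [InnerProductSpace ℂ H] [CompleteSpace H]

/-- `Λ_t A = ∫ π(g) A π(g)* dσ_t(g)` for some continuous unitary representation `π` in `H` of a
locally compact (second countable, Hausdorff) group and some family of finite signed Borel
measures `σ_t` on it. -/
def HasTwirlingForm (Λ : ℝ≥0 → ((H →L[ℂ] H) →ₗ[ℂ] (H →L[ℂ] H))) : Prop :=
  ∃ (G : Type u) (_ : Group G) (_ : TopologicalSpace G) (_ : IsTopologicalGroup G)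
    (_ : LocallyCompactSpace G) (_ : SecondCountableTopology G) (_ : T2Space G)
    (_ : MeasurableSpace G) (_ : BorelSpace G)
    (π : G →* unitary (H →L[ℂ] H)) (σ : ℝ≥0 → SignedMeasure G),
    Continuous π ∧ IsTwirlingIntegral Λ π σ

/-- A generalized twirling semigroup: `Λ_t A = ∫ π(g) A π(g)* dσ_t(g)` as above, with `(π, σ)`
satisfying the conditions of `IsTwirlingPair`. -/
def IsGeneralizedTwirling (Λ : ℝ≥0 → ((H →L[ℂ] H) →ₗ[ℂ] (H →L[ℂ] H))) : Prop :=
  ∃ (G : Type u) (_ : Group G) (_ : TopologicalSpace G) (_ : IsTopologicalGroup G)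
    (_ : LocallyCompactSpace G) (_ : SecondCountableTopology G) (_ : T2Space G)
    (_ : MeasurableSpace G) (_ : BorelSpace G)
    (π : G →* unitary (H →L[ℂ] H)) (σ : ℝ≥0 → SignedMeasure G),
    Continuous π ∧ IsTwirlingIntegral Λ π σ ∧ IsTwirlingPair π σ

end Forms

/-! ### The group `SU(d)` and its defining representation -/

/-- The group `SU(d)`, with the topology induced from the `d × d` complex matrices. -/
abbrev SU (d : ℕ) : Type := Matrix.specialUnitaryGroup (Fin d) ℂ

/-- `SU(d)` is endowed with its Borel `σ`-algebra. -/
instance SU.instMeasurableSpace (d : ℕ) : MeasurableSpace (SU d) := borel (SU d)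

instance SU.instBorelSpace (d : ℕ) : BorelSpace (SU d) := ⟨rfl⟩

section Defining

variable {H : Type*} [NormedAddCommGroup H] [InnerProductSpace ℂ H] [CompleteSpace H]
  [FiniteDimensional ℂ H]

/-- The identification of `d × d` matrices with operators on `H` given by an orthonormal
basis of `H`. -/
def opOfMatrix {d : ℕ} (ψ : OrthonormalBasis (Fin d) ℂ H) :
    Matrix (Fin d) (Fin d) ℂ ≃⋆ₐ[ℂ] (H →L[ℂ] H) :=
  (LinearMap.toMatrixOrthonormal ψ).symm.trans <|
    { LinearMap.toContinuousLinearMap with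
      map_mul' := fun _ _ => rfl
      map_star' := LinearMap.adjoint_toContinuousLinearMap }

/-- The defining representation of `SU(d)` in `H`, where `U(d)` is identified with the unitary
group of `H` by means of an orthonormal basis of `H`. -/
def definingRep {d : ℕ} (ψ : OrthonormalBasis (Fin d) ℂ H) : SU d →* unitary (H →L[ℂ] H) where
  toFun g := ⟨opOfMatrix ψ g.1,
    Unitary.map_mem (opOfMatrix ψ) (Matrix.specialUnitaryGroup_le_unitaryGroup g.2)⟩
  map_one' := Subtype.ext (map_one (opOfMatrix ψ))
  map_mul' g h := Subtype.ext (map_mul (opOfMatrix ψ) g.1 h.1)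

end Defining

end GenTwirling

end

open GenTwirling

/-! The central object is the map T_σ(A) = ∫ π(g) A π(g)* dσ(g). The integrals ∫ v_{jklm} dσ are its
matrix elements ⟨ψ_j, T_σ(|ψ_k⟩⟨ψ_l|) ψ_m⟩, and convolution of measures becomes composition of maps.
Hence (M2) says, with no basis left in it, that the T_{σ_t} compose like a semigroup and tend to the
identity (`condM2_iff`).

Existence of the measures is linear algebra: every trace-preserving unital map Φ is a linear
combination of unitary conjugations (`mem_unitaryConjSpan`). Indeed Φ − Id has traceless values and
kills 1, so it is a sum of maps A ↦ tr(AB) Y with B and Y traceless. Traceless operators are spanned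
by the |a⟩⟨b| with a ⊥ b, and for such B and Y the map is a corner A ↦ P A Q followed by one
conjugation. Corners are combinations of conjugations by z P + (1 − P) with z⁴ = 1. Preservation of
adjoints makes the coefficients real, so finitely supported signed measures suffice; phases cancel
in a conjugation, so SU(d) suffices.

Conversely, (M1) gives unitality and trace preservation, and real measures give adjoint
preservation. Positivity is Kossakowski's criterion: by (M3) the generator L satisfies ⟨ψ_j,
L(|ψ_k⟩⟨ψ_k|) ψ_j⟩ ≥ 0 for j ≠ k. Together with L1 = 0 this makes (1 − hL)⁻¹ respect upper bounds on
the spectrum (`NumBound.of_resolvent`). Since Λ_h agrees with that resolvent up to o(h), iteration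
passes the bounds on to Λ_t (`NumBound.semigroup`).

For the entropies, a positive, trace-preserving, unital map acts on eigenvalues by a doubly
stochastic matrix, so Jensen's inequality gives monotonicity. In the other direction the completely
mixed state is the unique maximizer, so a semigroup that does not decrease the entropy must fix it,
that is, be unital. The form (*) alone gives Λ_t 1 = σ_t(G) 1, and preservation of the trace then
forces σ_t(G) = 1. -/

namespace GenTwirling

/-! ### Integrals and convolutions of signed measures -/

section SignedIntegral

theorem integral_toSignedMeasure_sub {X E : Type*} [MeasurableSpace X] [NormedAddCommGroup E]
    [NormedSpace ℝ E] {μ ν : Measure X} [IsFiniteMeasure μ] [IsFiniteMeasure ν] {f : X → E}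
    (hμ : Integrable f μ) (hν : Integrable f ν) :
    ∫ᵛ x, f x ∂<•(μ.toSignedMeasure - ν.toSignedMeasure) = ∫ x, f x ∂μ - ∫ x, f x ∂ν := by
  rw [VectorMeasure.integral_sub_vectorMeasure]
  · simp
  · simpa [VectorMeasure.Integrable] using hμ
  · simpa [VectorMeasure.Integrable] using hν

theorem signedIntegral_eq {X E : Type*} [MeasurableSpace X] [NormedAddCommGroup E]
    [NormedSpace ℝ E] (σ : SignedMeasure X) {f : X → E}
    (hμ : Integrable f σ.toJordanDecomposition.posPart)
    (hν : Integrable f σ.toJordanDecomposition.negPart) :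
    ∫ᵛ x, f x ∂<•σ = ∫ x, f x ∂σ.toJordanDecomposition.posPart
      - ∫ x, f x ∂σ.toJordanDecomposition.negPart := by
  rw [← integral_toSignedMeasure_sub hμ hν]
  congr 1
  exact σ.toSignedMeasure_toJordanDecomposition.symm

/-- A continuous bounded function. -/
def IsContBdd {X E : Type*} [TopologicalSpace X] [NormedAddCommGroup E] (f : X → E) : Prop :=
  Continuous f ∧ ∃ C, ∀ x, ‖f x‖ ≤ C

variable {X E F : Type*} [TopologicalSpace X] [SecondCountableTopology X] [MeasurableSpace X]
  [BorelSpace X] [NormedAddCommGroup E] [NormedSpace ℝ E] [NormedAddCommGroup F] [NormedSpace ℝ F]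

omit [NormedSpace ℝ E] in
theorem IsContBdd.integrable {f : X → E} (hf : IsContBdd f) (μ : Measure X) [IsFiniteMeasure μ] :
    Integrable f μ := by
  obtain ⟨h, C, hC⟩ := hf
  exact Integrable.of_bound h.aestronglyMeasurable C (ae_of_all _ hC)

theorem IsContBdd.signedIntegral_eq {f : X → E} (hf : IsContBdd f) (σ : SignedMeasure X) :
    ∫ᵛ x, f x ∂<•σ = ∫ x, f x ∂σ.toJordanDecomposition.posPart
      - ∫ x, f x ∂σ.toJordanDecomposition.negPart :=
  GenTwirling.signedIntegral_eq σ (hf.integrable _) (hf.integrable _)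

omit [SecondCountableTopology X] [MeasurableSpace X] [BorelSpace X] in
theorem IsContBdd.clm_comp {f : X → E} (hf : IsContBdd f) (T : E →L[ℝ] F) :
    IsContBdd (fun x => T (f x)) := by
  obtain ⟨h, C, hC⟩ := hf
  refine ⟨by fun_prop, ‖T‖ * C, fun x => (T.le_opNorm _).trans ?_⟩
  gcongr
  exact hC x

theorem IsContBdd.signedIntegral_clm [CompleteSpace E] [CompleteSpace F] {f : X → E}
    (hf : IsContBdd f) (T : E →L[ℝ] F) (σ : SignedMeasure X) :
    ∫ᵛ x, T (f x) ∂<•σ = T (∫ᵛ x, f x ∂<•σ) := by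
  rw [hf.signedIntegral_eq, (hf.clm_comp T).signedIntegral_eq,
    T.integral_comp_comm (hf.integrable _), T.integral_comp_comm (hf.integrable _), map_sub]

variable {G : Type*} [Group G] [TopologicalSpace G] [IsTopologicalGroup G]
  [SecondCountableTopology G] [MeasurableSpace G] [BorelSpace G]

omit [TopologicalSpace G] [IsTopologicalGroup G] [SecondCountableTopology G] [BorelSpace G]
  [Group G] in
-- Bilinearity over the Jordan decompositions; a signed product is determined by its values on
-- rectangles. This reduces Fubini for signed measures to four finite positive product measures.
theorem signed_prod_eq (σ τ : SignedMeasure G) :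
    VectorMeasure.prod σ τ (ContinuousLinearMap.lsmul ℝ ℝ) =
      ((σ.toJordanDecomposition.posPart.prod τ.toJordanDecomposition.posPart +
        σ.toJordanDecomposition.negPart.prod τ.toJordanDecomposition.negPart).toSignedMeasure -
      (σ.toJordanDecomposition.posPart.prod τ.toJordanDecomposition.negPart +
        σ.toJordanDecomposition.negPart.prod τ.toJordanDecomposition.posPart).toSignedMeasure) := by
  refine VectorMeasure.prod_eq_of_forall_apply_prod fun s t hs ht => ?_
  rw [Measure.toSignedMeasure_sub_apply (hs.prod ht)]
  rw [measureReal_add_apply, measureReal_add_apply]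
  simp only [measureReal_prod_prod, ContinuousLinearMap.lsmul_apply, smul_eq_mul]
  conv_rhs => rw [← σ.toSignedMeasure_toJordanDecomposition,
    ← τ.toSignedMeasure_toJordanDecomposition]
  simp only [JordanDecomposition.toSignedMeasure]
  rw [Measure.toSignedMeasure_sub_apply hs, Measure.toSignedMeasure_sub_apply ht]
  ring

/-- Fubini for the convolution of signed measures. -/
theorem signedIntegral_conv [CompleteSpace E] {f : G → E} (hf : IsContBdd f)
    (σ τ : SignedMeasure G) (k : G → E) (hk : IsContBdd k)
    (hfk : ∀ g, ∫ᵛ h, f (g * h) ∂<•τ = k g) :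
    ∫ᵛ g, f g ∂<•(signedConv σ τ) = ∫ᵛ g, k g ∂<•σ := by
  have hf2 : IsContBdd (fun p : G × G => f (p.1 * p.2)) := by
    obtain ⟨h, C, hC⟩ := hf
    exact ⟨by fun_prop, C, fun x => hC _⟩
  have hf3 : ∀ g, IsContBdd (fun h => f (g * h)) := by
    obtain ⟨h, C, hC⟩ := hf
    exact fun g => ⟨by fun_prop, C, fun x => hC _⟩
  have hm : Measurable (fun p : G × G => p.1 * p.2) := measurable_mul
  unfold signedConv
  rw [VectorMeasure.integral_map hm hf.1.aestronglyMeasurable]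
  · rw [signed_prod_eq, integral_toSignedMeasure_sub (hf2.integrable _) (hf2.integrable _),
      integral_add_measure (hf2.integrable _) (hf2.integrable _),
      integral_add_measure (hf2.integrable _) (hf2.integrable _),
      integral_prod _ (hf2.integrable _), integral_prod _ (hf2.integrable _),
      integral_prod _ (hf2.integrable _), integral_prod _ (hf2.integrable _),
      hk.signedIntegral_eq]
    simp only [← hfk, (hf3 _).signedIntegral_eq]
    have h1 : ∀ μ ν : Measure G, IsFiniteMeasure μ → IsFiniteMeasure ν →
        Integrable (fun g => ∫ h, f (g * h) ∂ν) μ := fun μ ν _ _ =>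
      (hf2.integrable (μ.prod ν)).integral_prod_left
    rw [integral_sub, integral_sub]
    · abel
    all_goals exact h1 _ _ inferInstance inferInstance
  · exact hf2.integrable _

end SignedIntegral

/-! ### The twirling map of a signed measure -/

section Twirl

variable {H : Type*} [NormedAddCommGroup H] [InnerProductSpace ℂ H] [CompleteSpace H]
variable {G : Type*} [Group G] [MeasurableSpace G]

/-- The operator `∫ π(g) A π(g)* dσ(g)`. -/
noncomputable def twirl (π : G →* unitary (H →L[ℂ] H)) (σ : SignedMeasure G) (A : H →L[ℂ] H) :
    H →L[ℂ] H :=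
  ∫ᵛ g, ((π g : H →L[ℂ] H) * A * star (π g : H →L[ℂ] H)) ∂<•σ

variable [TopologicalSpace G] [SecondCountableTopology G] [BorelSpace G]
  {π : G →* unitary (H →L[ℂ] H)} (hπ : Continuous π) (σ : SignedMeasure G)

include hπ in
omit [MeasurableSpace G] [BorelSpace G] [SecondCountableTopology G] in
theorem isContBdd_conj (A : H →L[ℂ] H) :
    IsContBdd fun g => (π g : H →L[ℂ] H) * A * star (π g : H →L[ℂ] H) := by
  refine ⟨by fun_prop, ‖A‖, fun g => le_of_eq ?_⟩
  dsimp only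
  rw [← Unitary.coe_star, CStarRing.norm_mul_coe_unitary, CStarRing.norm_coe_unitary_mul]

include hπ

theorem twirl_clm {F : Type*} [NormedAddCommGroup F] [NormedSpace ℝ F] [CompleteSpace F]
    (T : (H →L[ℂ] H) →L[ℝ] F) (A : H →L[ℂ] H) :
    T (twirl π σ A) = ∫ᵛ g, T ((π g : H →L[ℂ] H) * A * star (π g : H →L[ℂ] H)) ∂<•σ :=
  ((isContBdd_conj hπ A).signedIntegral_clm T σ).symm

/-- Conjugation by π(gh) is conjugation by π(h) followed by conjugation by π(g), and the outer one,
being continuous and linear, passes through the inner integral. -/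
theorem twirl_signedConv [IsTopologicalGroup G] (σ τ : SignedMeasure G) (A : H →L[ℂ] H) :
    twirl π (signedConv σ τ) A = twirl π σ (twirl π τ A) := by
  refine signedIntegral_conv (isContBdd_conj hπ A) σ τ _ (isContBdd_conj hπ (twirl π τ A)) ?_
  intro g
  have := twirl_clm hπ τ (F := H →L[ℂ] H)
    ((((ContinuousLinearMap.mul ℂ (H →L[ℂ] H)).flip (star (π g : H →L[ℂ] H))).comp
      (ContinuousLinearMap.mul ℂ (H →L[ℂ] H) (π g : H →L[ℂ] H))).restrictScalars ℝ) A
  simp only [ContinuousLinearMap.coe_restrictScalars', ContinuousLinearMap.comp_apply,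
    ContinuousLinearMap.flip_apply, ContinuousLinearMap.mul_apply'] at this
  rw [this]
  simp [mul_assoc]

theorem inner_twirl (A : H →L[ℂ] H) (x y : H) :
    inner ℂ x (twirl π σ A y) =
      ∫ᵛ g, inner ℂ x (((π g : H →L[ℂ] H) * A * star (π g : H →L[ℂ] H)) y) ∂<•σ :=
  twirl_clm hπ σ (((innerSL ℂ x).comp
    (ContinuousLinearMap.apply ℂ H y)).restrictScalars ℝ) A

open InnerProductSpace in
-- This dictionary turns the scalar conditions on the measures into properties of the map.
theorem integral_matrixCoeff {ι : Type*} [Fintype ι] (ψ : OrthonormalBasis ι ℂ H) (j k l m : ι) :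
    ∫ᵛ g, matrixCoeff ψ π j k l m g ∂<•σ =
      inner ℂ (ψ j) (twirl π σ (rankOne ℂ (ψ k) (ψ l)) (ψ m)) := by
  rw [inner_twirl hπ]
  congr 1
  ext g
  simp [matrixCoeff, ContinuousLinearMap.star_eq_adjoint, ContinuousLinearMap.adjoint_inner_right,
    mul_comm]

theorem twirl_add (A B : H →L[ℂ] H) : twirl π σ (A + B) = twirl π σ A + twirl π σ B := by
  unfold twirl
  rw [← VectorMeasure.integral_fun_add]
  · simp [mul_add, add_mul]
  · exact (isContBdd_conj hπ A).integrable _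
  · exact (isContBdd_conj hπ B).integrable _

theorem twirl_smul (c : ℂ) (A : H →L[ℂ] H) : twirl π σ (c • A) = c • twirl π σ A := by
  have := twirl_clm hπ σ ((c • ContinuousLinearMap.id ℂ (H →L[ℂ] H)).restrictScalars ℝ) A
  simp only [ContinuousLinearMap.coe_restrictScalars', _root_.smul_apply,
    ContinuousLinearMap.id_apply] at this
  rw [this]
  simp [twirl]

theorem twirl_star (A : H →L[ℂ] H) : twirl π σ (star A) = star (twirl π σ A) := by
  have := twirl_clm hπ σ (starL' ℝ (A := H →L[ℂ] H)).toContinuousLinearMap A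
  simp only [ContinuousLinearEquiv.coe_coe, starL'_apply] at this
  rw [this]
  simp [twirl, mul_assoc]

omit hπ [TopologicalSpace G] [SecondCountableTopology G] [BorelSpace G] in
theorem twirl_one : twirl π σ 1 = σ Set.univ • 1 := by
  simp only [twirl, mul_one, Unitary.mul_star_self_of_mem (π _).2]
  rw [VectorMeasure.integral_const]
  simp

omit hπ in
theorem opTrace_conj (U : unitary (H →L[ℂ] H)) (A : H →L[ℂ] H) :
    opTrace ((U : H →L[ℂ] H) * A * star (U : H →L[ℂ] H)) = opTrace A := by
  unfold opTrace
  have : ∀ B C : H →L[ℂ] H, ((B * C : H →L[ℂ] H) : H →ₗ[ℂ] H) = (B : H →ₗ[ℂ] H) * C :=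
    fun _ _ => rfl
  rw [this, LinearMap.trace_mul_comm, ← this, ← mul_assoc, Unitary.star_mul_self_of_mem U.2,
    one_mul]

theorem opTrace_twirl [FiniteDimensional ℂ H] (A : H →L[ℂ] H) :
    opTrace (twirl π σ A) = σ Set.univ • opTrace A := by
  let T : (H →L[ℂ] H) →L[ℂ] ℂ := LinearMap.toContinuousLinearMap
    ((LinearMap.trace ℂ H).comp (ContinuousLinearMap.coeLM ℂ))
  have hT : ∀ A, T A = opTrace A := fun _ => rfl
  have := twirl_clm hπ σ (T.restrictScalars ℝ) A
  simp only [ContinuousLinearMap.coe_restrictScalars', hT, opTrace_conj] at this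
  rw [this, VectorMeasure.integral_const]
  simp

end Twirl

/-! ### Trace-preserving unital maps as combinations of unitary conjugations -/

section UnitarySpan

open InnerProductSpace

variable {H : Type*} [NormedAddCommGroup H] [InnerProductSpace ℂ H]

theorem opTrace_rankOne [FiniteDimensional ℂ H] (x y : H) :
    opTrace (rankOne ℂ x y) = inner ℂ y x :=
  InnerProductSpace.trace_rankOne x y

theorem opTrace_add (A B : H →L[ℂ] H) : opTrace (A + B) = opTrace A + opTrace B := by
  simp [opTrace]

theorem opTrace_sub (A B : H →L[ℂ] H) : opTrace (A - B) = opTrace A - opTrace B := by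
  simp [opTrace]

theorem opTrace_smul (c : ℂ) (A : H →L[ℂ] H) : opTrace (c • A) = c * opTrace A := by
  simp [opTrace]

theorem opTrace_one [FiniteDimensional ℂ H] :
    opTrace (1 : H →L[ℂ] H) = Module.finrank ℂ H := by
  simp [opTrace]

theorem opTrace_eq_sum_inner {ι : Type*} [Fintype ι] (A : H →L[ℂ] H)
    (b : OrthonormalBasis ι ℂ H) : opTrace A = ∑ i, inner ℂ (b i) (A (b i)) :=
  LinearMap.trace_eq_sum_inner _ b

theorem op_eq_sum_rankOne {ι : Type*} [Fintype ι] (b : OrthonormalBasis ι ℂ H)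
    (A : H →L[ℂ] H) :
    A = ∑ j, ∑ k, inner ℂ (b j) (A (b k)) • rankOne ℂ (b j) (b k) := by
  ext x
  conv_lhs => rw [← b.sum_repr' x]
  simp only [map_sum, map_smul, _root_.sum_apply, _root_.smul_apply, rankOne_apply]
  rw [Finset.sum_comm]
  refine Finset.sum_congr rfl fun k _ => ?_
  conv_lhs => rw [← b.sum_repr' (A (b k))]
  rw [Finset.smul_sum]
  exact Finset.sum_congr rfl fun j _ => smul_comm _ _ _

theorem one_eq_sum_rankOne {ι : Type*} [Fintype ι] (b : OrthonormalBasis ι ℂ H) :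
    (1 : H →L[ℂ] H) = ∑ j, rankOne ℂ (b j) (b j) := by
  ext x
  simp [b.sum_repr']

variable (H) in
/-- The operators `|a⟩⟨b|` with orthogonal unit vectors `a` and `b`. -/
def orthoRankOnes : Set (H →L[ℂ] H) :=
  {Y | ∃ a b : H, ‖a‖ = 1 ∧ ‖b‖ = 1 ∧ inner ℂ a b = 0 ∧ Y = rankOne ℂ a b}

/-- The vectors s(a + b) and s(a − b) with s = 1/√2 are again orthonormal, and twice their rank-one
operator is |a⟩⟨a| − |b⟩⟨b| up to the off-diagonal terms |a⟩⟨b| and |b⟩⟨a|. -/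
theorem rankOne_self_sub_mem_span {a b : H} (ha : ‖a‖ = 1) (hb : ‖b‖ = 1)
    (hab : inner ℂ a b = 0) :
    rankOne ℂ a a - rankOne ℂ b b ∈ Submodule.span ℂ (orthoRankOnes H) := by
  have hba : inner ℂ b a = 0 := inner_eq_zero_symm.1 hab
  have haa : inner ℂ a a = (1 : ℂ) := by simp [inner_self_eq_norm_sq_to_K, ha]
  have hbb : inner ℂ b b = (1 : ℂ) := by simp [inner_self_eq_norm_sq_to_K, hb]
  obtain ⟨s, hs, hsC⟩ : ∃ s : ℂ, starRingEnd ℂ s = s ∧ s * s = 1 / 2 := by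
    refine ⟨(√(1 / 2) : ℝ), Complex.conj_ofReal _, ?_⟩
    rw [← Complex.ofReal_mul, Real.mul_self_sqrt (by norm_num)]
    norm_num
  have n1 : ‖s • (a + b)‖ = 1 := by
    have : inner ℂ (s • (a + b)) (s • (a + b)) = (1 : ℂ) := by
      simp only [inner_smul_left, inner_smul_right, inner_add_left, inner_add_right, haa, hbb, hab,
        hba, hs]
      linear_combination 2 * hsC
    rw [norm_eq_sqrt_re_inner (𝕜 := ℂ), this]
    simp
  have n2 : ‖s • (a - b)‖ = 1 := by
    have : inner ℂ (s • (a - b)) (s • (a - b)) = (1 : ℂ) := by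
      simp only [inner_smul_left, inner_smul_right, inner_sub_left, inner_sub_right, haa, hbb, hab,
        hba, hs]
      linear_combination 2 * hsC
    rw [norm_eq_sqrt_re_inner (𝕜 := ℂ), this]
    simp
  have m1 : rankOne ℂ (s • (a + b)) (s • (a - b)) ∈ Submodule.span ℂ (orthoRankOnes H) := by
    refine Submodule.subset_span ⟨_, _, n1, n2, ?_, rfl⟩
    simp only [inner_smul_left, inner_smul_right, inner_sub_right, inner_add_left, haa, hbb, hab,
      hba]
    ring
  have m2 : rankOne ℂ a b ∈ Submodule.span ℂ (orthoRankOnes H) :=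
    Submodule.subset_span ⟨_, _, ha, hb, hab, rfl⟩
  have m3 : rankOne ℂ b a ∈ Submodule.span ℂ (orthoRankOnes H) :=
    Submodule.subset_span ⟨_, _, hb, ha, hba, rfl⟩
  have : rankOne ℂ a a - rankOne ℂ b b = (2 : ℂ) • rankOne ℂ (s • (a + b)) (s • (a - b)) +
      rankOne ℂ a b - rankOne ℂ b a := by
    have e : rankOne ℂ (s • (a + b)) (s • (a - b)) = (s * s) •
        (rankOne ℂ a a - rankOne ℂ a b + rankOne ℂ b a - rankOne ℂ b b) := by
      ext x
      simp only [rankOne_apply, _root_.smul_apply, _root_.add_apply, _root_.sub_apply,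
        inner_smul_left, inner_sub_left, hs]
      module
    rw [e, hsC]
    module
  rw [this]
  exact Submodule.sub_mem _ (Submodule.add_mem _ (Submodule.smul_mem _ _ m1) m2) m3

theorem rankOne_basis_sub_mem_span [FiniteDimensional ℂ H] {d : ℕ} (hd : d ≠ 0)
    (b : OrthonormalBasis (Fin d) ℂ H) (j k : Fin d) :
    rankOne ℂ (b j) (b k) - (if j = k then (1 / d : ℂ) else 0) • (1 : H →L[ℂ] H) ∈
      Submodule.span ℂ (orthoRankOnes H) := by
  split_ifs with h
  · subst h
    have hd' : (d : ℂ) ≠ 0 := Nat.cast_ne_zero.2 hd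
    have : rankOne ℂ (b j) (b j) - (1 / d : ℂ) • (1 : H →L[ℂ] H) =
        (1 / d : ℂ) • ∑ k, (rankOne ℂ (b j) (b j) - rankOne ℂ (b k) (b k)) := by
      rw [Finset.sum_sub_distrib, ← one_eq_sum_rankOne b, smul_sub]
      simp only [Finset.sum_const, Finset.card_univ, Fintype.card_fin]
      rw [← Nat.cast_smul_eq_nsmul ℂ, smul_smul, one_div_mul_cancel hd', one_smul]
    rw [this]
    refine Submodule.smul_mem _ _ (Submodule.sum_mem _ fun k _ => ?_)
    by_cases hjk : j = k
    · simp [hjk]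
    · exact rankOne_self_sub_mem_span (b.norm_eq_one j) (b.norm_eq_one k)
        (b.inner_eq_zero hjk)
  · rw [zero_smul, sub_zero]
    exact Submodule.subset_span ⟨_, _, b.norm_eq_one j, b.norm_eq_one k, b.inner_eq_zero h, rfl⟩

theorem mem_span_orthoRankOnes [FiniteDimensional ℂ H] {d : ℕ} (hd : d ≠ 0)
    (b : OrthonormalBasis (Fin d) ℂ H) {Y : H →L[ℂ] H} (hY : opTrace Y = 0) :
    Y ∈ Submodule.span ℂ (orthoRankOnes H) := by
  -- The subtracted multiples of 1 add up to (tr Y / d) 1, which vanishes.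
  have : Y = ∑ j, ∑ k, inner ℂ (b j) (Y (b k)) •
      (rankOne ℂ (b j) (b k) - (if j = k then (1 / d : ℂ) else 0) • (1 : H →L[ℂ] H)) := by
    simp only [smul_sub, Finset.sum_sub_distrib, smul_smul, ← op_eq_sum_rankOne b Y]
    rw [eq_comm, sub_eq_self]
    simp only [mul_ite, mul_zero, ite_smul, zero_smul, Finset.sum_ite_eq, Finset.mem_univ, if_true]
    rw [← Finset.sum_smul, ← Finset.sum_mul, ← opTrace_eq_sum_inner, hY, zero_mul, zero_smul]
  rw [this]
  exact Submodule.sum_mem _ fun j _ => Submodule.sum_mem _ fun k _ =>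
    Submodule.smul_mem _ _ (rankOne_basis_sub_mem_span hd b j k)

variable [CompleteSpace H]

/-- Conjugation by a unitary operator. -/
noncomputable def unitaryConj : unitary (H →L[ℂ] H) →* Module.End ℂ (H →L[ℂ] H) where
  toFun U := (LinearMap.mulRight ℂ (star (U : H →L[ℂ] H))).comp
    (LinearMap.mulLeft ℂ (U : H →L[ℂ] H))
  map_one' := by ext; simp
  map_mul' U V := by ext; simp [mul_assoc]

theorem unitaryConj_apply (U : unitary (H →L[ℂ] H)) (A : H →L[ℂ] H) :
    unitaryConj U A = U * A * star (U : H →L[ℂ] H) := rfl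

variable (H) in
/-- The complex span of the unitary conjugations. -/
noncomputable def unitaryConjSpan : Submodule ℂ (Module.End ℂ (H →L[ℂ] H)) :=
  Submodule.span ℂ (Set.range unitaryConj)

theorem unitaryConj_mem (U : unitary (H →L[ℂ] H)) : unitaryConj U ∈ unitaryConjSpan H :=
  Submodule.subset_span ⟨U, rfl⟩

theorem mul_mem_unitaryConjSpan {f g : Module.End ℂ (H →L[ℂ] H)} (hf : f ∈ unitaryConjSpan H)
    (hg : g ∈ unitaryConjSpan H) : f * g ∈ unitaryConjSpan H := by
  have := Submodule.mul_mem_mul hf hg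
  rw [unitaryConjSpan, Submodule.span_mul_span] at this
  refine Submodule.span_mono ?_ this
  rintro _ ⟨_, ⟨U, rfl⟩, _, ⟨V, rfl⟩, rfl⟩
  exact ⟨U * V, map_mul _ _ _⟩

/-- The unitary operator `z P + (1 - P)`. -/
noncomputable def phaseUnitary (P : H →L[ℂ] H) (hP : IsStarProjection P) (z : ℂ) (hz : z * star z = 1) :
    unitary (H →L[ℂ] H) :=
  ⟨z • P + (1 - P), by
    have h1 : P * P = P := hP.1
    have h2 : star P = P := hP.2
    have hz' : star z * z = 1 := by rw [mul_comm, hz]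
    rw [Unitary.mem_iff]
    constructor <;>
    · simp only [star_add, star_smul, star_sub, star_one, h2, mul_add, add_mul, mul_sub, sub_mul,
        smul_mul_assoc, mul_smul_comm, h1, mul_one, one_mul, smul_add, smul_smul, hz, hz',
        sub_self]
      module⟩

/-- Conjugating by z P + (1 − P) multiplies the two off-diagonal blocks of A by z and by its
conjugate, and fixes the diagonal blocks. Fourier inversion over z = 1, −1, i, −i isolates either
off-diagonal block. -/
theorem exists_corner_mem_unitaryConjSpan {P : H →L[ℂ] H} (hP : IsStarProjection P) :
    (∃ f ∈ unitaryConjSpan H, ∀ A, f A = P * A * (1 - P)) ∧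
    (∃ f ∈ unitaryConjSpan H, ∀ A, f A = (1 - P) * A * P) := by
  let C : ∀ z : ℂ, z * star z = 1 → Module.End ℂ (H →L[ℂ] H) := fun z hz =>
    unitaryConj (phaseUnitary P hP z hz)
  have h2 : star P = P := hP.2
  have hC : ∀ z hz A, C z hz A = (z * star z) • (P * A * P) + z • (P * A * (1 - P)) +
      star z • ((1 - P) * A * P) + (1 - P) * A * (1 - P) := by
    intro z hz A
    change (z • P + (1 - P)) * A * star (z • P + (1 - P)) = _
    rw [star_add, star_smul, star_sub, star_one, h2]
    generalize 1 - P = Q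
    simp only [mul_add, add_mul, smul_mul_assoc, mul_smul_comm]
    module
  have hm : ∀ z hz, C z hz ∈ unitaryConjSpan H := fun z hz => unitaryConj_mem _
  have z1 : (1 : ℂ) * star 1 = 1 := by simp
  have z2 : (-1 : ℂ) * star (-1) = 1 := by simp
  have z3 : Complex.I * star Complex.I = 1 := by simp
  have z4 : (-Complex.I) * star (-Complex.I) = 1 := by simp
  constructor
  · refine ⟨(1 / 4 : ℂ) • (C 1 z1 - C (-1) z2 - Complex.I • (C Complex.I z3 - C (-Complex.I) z4)),
      Submodule.smul_mem _ _ (Submodule.sub_mem _ (Submodule.sub_mem _ (hm _ _) (hm _ _))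
        (Submodule.smul_mem _ _ (Submodule.sub_mem _ (hm _ _) (hm _ _)))), fun A => ?_⟩
    simp only [LinearMap.smul_apply, LinearMap.sub_apply, hC, z1, z2, z3, z4]
    simp only [star_one, star_neg, Complex.star_def, Complex.conj_I]
    simp only [smul_add, smul_sub, smul_smul, mul_neg, Complex.I_mul_I, neg_neg]
    module
  · refine ⟨(1 / 4 : ℂ) • (C 1 z1 - C (-1) z2 + Complex.I • (C Complex.I z3 - C (-Complex.I) z4)),
      Submodule.smul_mem _ _ (Submodule.add_mem _ (Submodule.sub_mem _ (hm _ _) (hm _ _))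
        (Submodule.smul_mem _ _ (Submodule.sub_mem _ (hm _ _) (hm _ _)))), fun A => ?_⟩
    simp only [LinearMap.smul_apply, LinearMap.sub_apply, LinearMap.add_apply, hC, z1, z2, z3, z4]
    simp only [star_one, star_neg, Complex.star_def, Complex.conj_I]
    simp only [smul_add, smul_sub, smul_smul, mul_neg, Complex.I_mul_I, neg_neg]
    module

theorem isStarProjection_rankOne {a : H} (ha : ‖a‖ = 1) : IsStarProjection (rankOne ℂ a a) := by
  refine ⟨isIdempotentElem_rankOne_self ha, ?_⟩
  rw [IsSelfAdjoint, ContinuousLinearMap.star_eq_adjoint]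
  simp

theorem exists_unitary_map_pair [FiniteDimensional ℂ H] {d : ℕ} (hd : 2 ≤ d)
    (hdim : Module.finrank ℂ H = d) {a b a' b' : H} (ha : ‖a‖ = 1) (hb : ‖b‖ = 1)
    (hab : inner ℂ a b = 0) (ha' : ‖a'‖ = 1) (hb' : ‖b'‖ = 1) (hab' : inner ℂ a' b' = 0) :
    ∃ U : unitary (H →L[ℂ] H), (U : H →L[ℂ] H) a = a' ∧ (U : H →L[ℂ] H) b = b' := by
  -- Any orthonormal pair is the beginning of an orthonormal basis; d ≥ 2 provides the indices 0 and
  -- 1. The unitary then maps one basis to the other.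
  have ext : ∀ a b : H, ‖a‖ = 1 → ‖b‖ = 1 → inner ℂ a b = 0 →
      ∃ e : OrthonormalBasis (Fin d) ℂ H, e ⟨0, by omega⟩ = a ∧ e ⟨1, by omega⟩ = b := by
    intro a b ha hb hab
    have hba : inner ℂ b a = 0 := inner_eq_zero_symm.1 hab
    let w : Fin d → H := fun i => if i = ⟨0, by omega⟩ then a else b
    have hw : Orthonormal ℂ (({⟨0, by omega⟩, ⟨1, by omega⟩} : Set (Fin d)).domRestrict w) := by
      constructor
      · rintro ⟨i, hi⟩
        change ‖w i‖ = 1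
        simp only [w]
        split_ifs <;> assumption
      · rintro ⟨i, hi⟩ ⟨j, hj⟩ hij
        change inner ℂ (w i) (w j) = 0
        rcases hi with rfl | rfl <;> rcases hj with rfl | rfl <;> simp_all [w]
    obtain ⟨e, he⟩ := hw.exists_orthonormalBasis_extension_of_card_eq (by simpa using hdim)
    refine ⟨e, ?_, ?_⟩
    · rw [he _ (Or.inl rfl)]
      exact if_pos rfl
    · rw [he _ (Or.inr rfl)]
      exact if_neg (by simp)
  obtain ⟨e, e0, e1⟩ := ext a b ha hb hab
  obtain ⟨e', e0', e1'⟩ := ext a' b' ha' hb' hab'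
  refine ⟨Unitary.linearIsometryEquiv.symm (e.equiv e' (Equiv.refl _)), ?_, ?_⟩
  · rw [← e0, ← e0']; simp
  · rw [← e1, ← e1']; simp

/-- The functional `A ↦ tr (A B)`, tensored with the operator `Y`. -/
noncomputable def traceSmulRight (B Y : H →L[ℂ] H) : Module.End ℂ (H →L[ℂ] H) where
  toFun A := opTrace (A * B) • Y
  map_add' A A' := by rw [add_mul, opTrace_add, add_smul]
  map_smul' c A := by rw [smul_mul_assoc, opTrace_smul, mul_smul]; rfl

omit [CompleteSpace H] in
theorem traceSmulRight_apply (A B Y : H →L[ℂ] H) :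
    traceSmulRight B Y A = opTrace (A * B) • Y := rfl

theorem traceSmulRight_orthoRankOnes_mem [FiniteDimensional ℂ H]
    (hd : 2 ≤ Module.finrank ℂ H) {B Y : H →L[ℂ] H} (hB : B ∈ orthoRankOnes H)
    (hY : Y ∈ orthoRankOnes H) : traceSmulRight B Y ∈ unitaryConjSpan H := by
  obtain ⟨b, a, hb, ha, hba, rfl⟩ := hB
  obtain ⟨a', b', ha', hb', hab', rfl⟩ := hY
  have hab : inner ℂ a b = 0 := inner_eq_zero_symm.1 hba
  obtain ⟨U, hUa, hUb⟩ := exists_unitary_map_pair hd rfl ha hb hab ha' hb' hab'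
  obtain ⟨f, hf, hfA⟩ := (exists_corner_mem_unitaryConjSpan (isStarProjection_rankOne ha)).1
  obtain ⟨g, hg, hgA⟩ := (exists_corner_mem_unitaryConjSpan (isStarProjection_rankOne hb)).2
  -- The composite of the two corners is A ↦ |a⟩⟨a| A |b⟩⟨b| = ⟨a, A b⟩ |a⟩⟨b|, because a ⊥ b; the
  -- scalar is tr(A |b⟩⟨a|), and U carries |a⟩⟨b| to |a'⟩⟨b'|.
  have : traceSmulRight (rankOne ℂ b a) (rankOne ℂ a' b') = unitaryConj U * (f * g) := by
    refine LinearMap.ext fun A => ?_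
    have e1 : rankOne ℂ a a * rankOne ℂ b b = 0 := by
      ext x; simp [hab]
    have e2 : rankOne ℂ b b * rankOne ℂ a a = 0 := by
      ext x; simp [hba]
    have e3 : f (g A) = rankOne ℂ a a * A * rankOne ℂ b b := by
      rw [hfA, hgA]
      simp only [mul_sub, sub_mul, mul_one, one_mul, mul_assoc, e2, mul_zero, sub_zero]
      rw [← mul_assoc _ _ (A * _), e1, zero_mul, sub_zero]
    have e4 : A * rankOne ℂ b a = rankOne ℂ (A b) a := by
      ext x; simp
    rw [Module.End.mul_apply, Module.End.mul_apply, e3, traceSmulRight_apply, unitaryConj_apply,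
      e4, opTrace_rankOne]
    ext x
    simp only [ContinuousLinearMap.star_eq_adjoint, mul_apply_eq_comp,
      _root_.smul_apply, rankOne_apply, map_smul, hUa, ContinuousLinearMap.adjoint_inner_right, hUb]
    exact smul_comm _ _ _
  rw [this]
  exact mul_mem_unitaryConjSpan (unitaryConj_mem U) (mul_mem_unitaryConjSpan hf hg)

theorem traceSmulRight_mem [FiniteDimensional ℂ H] (hd : 2 ≤ Module.finrank ℂ H)
    {B Y : H →L[ℂ] H} (hB : opTrace B = 0) (hY : opTrace Y = 0) :
    traceSmulRight B Y ∈ unitaryConjSpan H := by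
  have hB' := mem_span_orthoRankOnes (by omega) (stdOrthonormalBasis ℂ H) hB
  have hY' := mem_span_orthoRankOnes (by omega) (stdOrthonormalBasis ℂ H) hY
  clear hB hY
  induction hB', hY' using Submodule.span_induction₂ with
  | mem_mem B Y hB hY => exact traceSmulRight_orthoRankOnes_mem hd hB hY
  | zero_left Y hY =>
    convert Submodule.zero_mem _
    ext1 A; simp [traceSmulRight_apply, opTrace]
  | zero_right B hB =>
    convert Submodule.zero_mem _
    ext1 A; simp [traceSmulRight_apply]
  | add_left B B' Y _ _ _ h h' =>
    convert Submodule.add_mem _ h h'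
    ext1 A; simp [traceSmulRight_apply, mul_add, opTrace_add, add_smul]
  | add_right B Y Y' _ _ _ h h' =>
    convert Submodule.add_mem _ h h'
    ext1 A; simp [traceSmulRight_apply]
  | smul_left c B Y _ _ h =>
    convert Submodule.smul_mem _ c h
    ext1 A; simp [traceSmulRight_apply, opTrace_smul, mul_smul]
  | smul_right c B Y _ _ h =>
    convert Submodule.smul_mem _ c h
    ext1 A; simp [traceSmulRight_apply, smul_comm c]

theorem mem_unitaryConjSpan [FiniteDimensional ℂ H] (hd : 2 ≤ Module.finrank ℂ H)
    {Φ : Module.End ℂ (H →L[ℂ] H)} (htr : IsTracePreserving Φ) (hu : IsUnital Φ) :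
    Φ ∈ unitaryConjSpan H := by
  let b := stdOrthonormalBasis ℂ H
  let Ψ := Φ - 1
  have hΨ : ∀ A, opTrace (Ψ A) = 0 := fun A => by
    simp [Ψ, opTrace_sub, htr A]
  have hΨ1 : Ψ 1 = 0 := by simp [Ψ, show Φ 1 = 1 from hu]
  have hd0 : (Module.finrank ℂ H : ℂ) ≠ 0 := Nat.cast_ne_zero.2 (by omega)
  -- This is Ψ applied to the expansion of A in matrix units. The terms in 1/d make the first
  -- argument traceless at no cost: they contribute a multiple of Ψ(1) = 0.
  have key : Ψ = ∑ j, ∑ k, traceSmulRight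
      (rankOne ℂ (b k) (b j) - (if k = j then (1 / Module.finrank ℂ H : ℂ) else 0) • (1 : H →L[ℂ] H))
      (Ψ (rankOne ℂ (b j) (b k))) := by
    refine LinearMap.ext fun A => ?_
    have e : ∀ j k, A * rankOne ℂ (b k) (b j) = rankOne ℂ (A (b k)) (b j) := fun j k => by
      ext x; simp
    simp only [LinearMap.sum_apply, traceSmulRight_apply, mul_sub, opTrace_sub, e, opTrace_rankOne,
      mul_smul_comm, mul_one, opTrace_smul, sub_smul, Finset.sum_sub_distrib]
    simp only [ite_mul, zero_mul, ite_smul, zero_smul, Finset.sum_ite_eq', Finset.mem_univ,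
      if_true]
    rw [← Finset.smul_sum, ← map_sum, ← one_eq_sum_rankOne b, hΨ1, smul_zero, sub_zero]
    conv_lhs => rw [op_eq_sum_rankOne b A]
    simp [map_sum]
  have hΨm : Ψ ∈ unitaryConjSpan H := by
    rw [key]
    refine Submodule.sum_mem _ fun j _ => Submodule.sum_mem _ fun k _ =>
      traceSmulRight_mem hd ?_ (hΨ _)
    rw [opTrace_sub, opTrace_smul, opTrace_one, opTrace_rankOne,
      orthonormal_iff_ite.1 b.orthonormal]
    by_cases h : j = k
    · simp only [h, if_true]; rw [one_div_mul_cancel hd0, sub_self]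
    · simp [h, Ne.symm h]
  have : Φ = Ψ + unitaryConj 1 := by simp [Ψ]
  rw [this]
  exact Submodule.add_mem _ hΨm (unitaryConj_mem 1)

/-- A trace-preserving, unital, adjoint-preserving map is a finite real combination of unitary
conjugations. -/
theorem exists_real_combination [FiniteDimensional ℂ H] (hd : 2 ≤ Module.finrank ℂ H)
    {Φ : Module.End ℂ (H →L[ℂ] H)} (htr : IsTracePreserving Φ) (hu : IsUnital Φ)
    (hstar : ∀ A, Φ (star A) = star (Φ A)) :
    ∃ (s : Finset (unitary (H →L[ℂ] H))) (c : unitary (H →L[ℂ] H) → ℝ),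
      ∀ A, Φ A = ∑ U ∈ s, c U • ((U : H →L[ℂ] H) * A * star (U : H →L[ℂ] H)) := by
  obtain ⟨c, hc⟩ := Finsupp.mem_span_range_iff_exists_finsupp.1 (mem_unitaryConjSpan hd htr hu)
  have h1 : ∀ A, Φ A = ∑ U ∈ c.support, c U • ((U : H →L[ℂ] H) * A * star (U : H →L[ℂ] H)) := by
    intro A
    rw [← hc, Finsupp.sum, LinearMap.sum_apply]
    rfl
  refine ⟨c.support, fun U => (c U).re, fun A => ?_⟩
  -- Preservation of adjoints lets the conjugate coefficients represent Φ as well; averaging the two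
  -- representations leaves the real parts.
  have h2 : Φ A = ∑ U ∈ c.support, star (c U) •
      ((U : H →L[ℂ] H) * A * star (U : H →L[ℂ] H)) := by
    have := hstar (star A)
    rw [star_star] at this
    rw [this, h1, star_sum]
    simp [mul_assoc]
  have h3 : Φ A = (1 / 2 : ℂ) • (Φ A + Φ A) := by module
  rw [h3]
  nth_rewrite 1 [h1]
  rw [h2, ← Finset.sum_add_distrib, Finset.smul_sum]
  refine Finset.sum_congr rfl fun U _ => ?_
  rw [← add_smul, smul_smul, ← Complex.coe_smul]
  congr 1
  rw [Complex.star_def, Complex.add_conj]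
  push_cast
  ring

end UnitarySpan
-- Existence of the generator
section Generator

theorem tendsto_coe_nhdsGT_zero :
    Tendsto (fun t : ℝ≥0 => (t : ℝ)) (𝓝[>] 0) (𝓝[>] 0) := by
  refine tendsto_nhdsWithin_iff.2 ⟨?_, ?_⟩
  · have : Tendsto (fun t : ℝ≥0 => (t : ℝ)) (𝓝 0) (𝓝 0) := by
      simpa using (NNReal.continuous_coe.tendsto 0)
    exact this.mono_left nhdsWithin_le_nhds
  · filter_upwards [self_mem_nhdsWithin] with t ht
    exact_mod_cast ht

theorem eventually_nhdsGT_zero_nnreal {p : ℝ≥0 → Prop} (h : ∀ᶠ t in 𝓝[>] (0 : ℝ≥0), p t) :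
    ∃ δ > 0, ∀ t, 0 < t → t < δ → p t := by
  obtain ⟨δ, hδ, hp⟩ := mem_nhdsGT_iff_exists_Ioo_subset.1 h
  exact ⟨δ, hδ, fun t h1 h2 => hp ⟨h1, h2⟩⟩

/-- A norm-continuous one-parameter semigroup in a Banach algebra is differentiable at `0`. -/
theorem exists_generator {𝔸 : Type*} [NormedRing 𝔸] [NormedAlgebra ℂ 𝔸] [CompleteSpace 𝔸]
    (T : ℝ≥0 → 𝔸) (hT0 : T 0 = 1) (hT : ∀ s t, T (s + t) = T s * T t)
    (hc : Tendsto T (𝓝[>] 0) (𝓝 1)) :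
    ∃ L : 𝔸, Tendsto (fun t : ℝ≥0 => ((t : ℝ) : ℂ)⁻¹ • (T t - 1)) (𝓝[>] 0) (𝓝 L) := by
  obtain ⟨δ, hδ, hbd⟩ : ∃ δ > 0, ∀ t < δ, ‖T t‖ ≤ ‖(1 : 𝔸)‖ + 1 := by
    have : ∀ᶠ t in 𝓝[>] (0 : ℝ≥0), ‖T t‖ ≤ ‖(1 : 𝔸)‖ + 1 :=
      hc.norm.eventually (eventually_le_nhds (by linarith))
    obtain ⟨δ, hδ, h⟩ := eventually_nhdsGT_zero_nnreal this
    refine ⟨δ, hδ, fun t ht => ?_⟩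
    rcases eq_or_ne t 0 with rfl | h0
    · rw [hT0]; linarith
    · exact h t (pos_iff_ne_zero.2 h0) ht
  have hc0 : Tendsto T (𝓝 0) (𝓝 1) := by
    have h1 : 𝓝 (0 : ℝ≥0) = 𝓝[>] 0 ⊔ pure 0 := by
      have : (Set.univ : Set ℝ≥0) = Set.Ioi 0 ∪ {0} := by
        ext x
        simp
      rw [← nhdsWithin_univ, this, nhdsWithin_union, nhdsWithin_singleton]
    rw [h1]
    refine Tendsto.sup hc ?_
    rw [tendsto_pure_left]
    intro s hs
    rw [hT0]
    exact mem_of_mem_nhds hs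
  -- With truncated subtraction, (t − s) + (s − t) is |t − s|.
  have hdist : ∀ s t : ℝ≥0, s < δ → t < δ →
      ‖T t - T s‖ ≤ (‖(1 : 𝔸)‖ + 1) * ‖T ((t - s) + (s - t)) - 1‖ := by
    have : ∀ s t : ℝ≥0, s ≤ t → s < δ → t < δ →
        ‖T t - T s‖ ≤ (‖(1 : 𝔸)‖ + 1) * ‖T (t - s) - 1‖ := by
      intro s t hst hs ht
      have e : T t - T s = T s * (T (t - s) - 1) := by
        rw [mul_sub, ← hT, add_tsub_cancel_of_le hst, mul_one]
      rw [e]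
      refine (norm_mul_le _ _).trans ?_
      gcongr
      exact hbd s hs
    intro s t hs ht
    rcases le_total s t with h | h
    · simpa [tsub_eq_zero_of_le h] using this s t h hs ht
    · rw [norm_sub_rev]
      simpa [tsub_eq_zero_of_le h] using this t s h ht hs
  have hcont : ContinuousOn T (Set.Iio δ) := by
    intro s hs
    refine ContinuousAt.continuousWithinAt ?_
    rw [ContinuousAt, tendsto_iff_norm_sub_tendsto_zero]
    have h1 : Tendsto (fun t : ℝ≥0 => (‖(1 : 𝔸)‖ + 1) * ‖T ((t - s) + (s - t)) - 1‖) (𝓝 s)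
        (𝓝 0) := by
      have h2 : Tendsto (fun t : ℝ≥0 => (t - s) + (s - t)) (𝓝 s) (𝓝 0) := by
        have : Continuous (fun t : ℝ≥0 => (t - s) + (s - t)) := by fun_prop
        simpa using this.tendsto s
      have h3 := ((hc0.comp h2).sub_const 1).norm.const_mul (‖(1 : 𝔸)‖ + 1)
      simpa using h3
    refine squeeze_zero' (Eventually.of_forall fun _ => norm_nonneg _) ?_ h1
    filter_upwards [Iio_mem_nhds hs] with t ht
    exact hdist s t hs ht
  let δ' := δ / 2
  have hδ' : δ' < δ := NNReal.half_lt_self hδ.ne'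
  have hδ'0 : 0 < δ' := half_pos hδ
  -- Capping the argument at δ' < δ extends the semigroup near 0 to a continuous function on the
  -- whole line.
  let f : ℝ → 𝔸 := fun x => T (min x.toNNReal δ')
  have hf : Continuous f := by
    refine hcont.comp_continuous (by fun_prop) fun x => ?_
    exact (min_le_right _ _).trans_lt hδ'
  have hfT : ∀ x : ℝ≥0, x ≤ δ' → f x = T x := fun x hx => by
    simp [f, hx]
  let W : ℝ → 𝔸 := fun a => ∫ x in (0 : ℝ)..a, f x
  have hW : ∀ a, HasDerivAt W (f a) a := fun a => (hf.integral_hasStrictDerivAt 0 a).hasDerivAt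
  have hW0 : W 0 = 0 := by simp [W]
  have hlim := (hW 0).tendsto_slope_zero_right
  have hf0 : f 0 = 1 := by simp [f, hT0]
  simp only [zero_add, hW0, sub_zero, hf0] at hlim
  -- The averages W(a)/a tend to 1 and units form an open set, so W(a) is invertible for small a.
  have hunit : ∀ᶠ a in 𝓝[>] (0 : ℝ), IsUnit (a⁻¹ • W a) :=
    hlim.eventually (Units.isOpen.mem_nhds isUnit_one)
  obtain ⟨a, hau, ha0, haδ⟩ : ∃ a : ℝ, IsUnit (a⁻¹ • W a) ∧ 0 < a ∧ a < δ' / 2 := by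
    have h2 : ∀ᶠ a : ℝ in 𝓝[>] (0 : ℝ), 0 < a ∧ a < δ' / 2 := by
      have : (0 : ℝ) < δ' / 2 := by positivity
      filter_upwards [Ioo_mem_nhdsGT this] with x hx using hx
    exact (hunit.and h2).exists
  obtain ⟨R, hR⟩ : ∃ R, W a * R = 1 := by
    obtain ⟨R, hR⟩ := hau.exists_right_inv
    exact ⟨a⁻¹ • R, by rw [mul_smul_comm, ← smul_mul_assoc, hR]⟩
  -- Multiplication by T h shifts the integrand. Both a and h stay below δ'/2, so the cap is never
  -- reached. Dividing by h and cancelling W(a) gives the derivative at 0.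
  have key : ∀ h : ℝ≥0, (h : ℝ) < δ' / 2 →
      (T h - 1) * W a = (W (a + h) - W a) - (W (0 + h) - W 0) := by
    intro h hh
    have e1 : T h * W a = ∫ x in (0 : ℝ)..a, f (x + h) := by
      have := ((ContinuousLinearMap.mul ℂ 𝔸 (T h)).restrictScalars ℝ).intervalIntegral_comp_comm
        (hf.intervalIntegrable (μ := volume) 0 a)
      simp only [ContinuousLinearMap.coe_restrictScalars', ContinuousLinearMap.mul_apply'] at this
      rw [← this]
      refine intervalIntegral.integral_congr fun x hx => ?_
      rw [Set.uIcc_of_le ha0.le] at hx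
      lift x to ℝ≥0 using hx.1
      have hx2 : (x : ℝ) ≤ a := hx.2
      have l1 : x ≤ δ' := by
        rw [← NNReal.coe_le_coe]; have : (0 : ℝ) ≤ δ' := NNReal.coe_nonneg _; linarith
      have l2 : x + h ≤ δ' := by
        rw [← NNReal.coe_le_coe, NNReal.coe_add]; linarith
      rw [← NNReal.coe_add, hfT _ l1, hfT _ l2, ← hT, add_comm]
    rw [sub_mul, one_mul, e1, intervalIntegral.integral_comp_add_right]
    have i : ∀ x y, IntervalIntegrable f volume x y := fun x y => hf.intervalIntegrable x y
    rw [← intervalIntegral.integral_interval_sub_left (i 0 _) (i 0 _)]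
    simp only [W, hW0]
    abel
  refine ⟨(f a - f 0) * R, ?_⟩
  have l1 := (((hW a).tendsto_slope_zero_right.sub (hW 0).tendsto_slope_zero_right).comp
    tendsto_coe_nhdsGT_zero).mul_const R
  refine l1.congr' ?_
  have h2 : ∀ᶠ h : ℝ≥0 in 𝓝[>] 0, (h : ℝ) < δ' / 2 := by
    have : (0 : ℝ) < δ' / 2 := by positivity
    exact tendsto_coe_nhdsGT_zero.eventually
      (mem_of_superset (Ioo_mem_nhdsGT this) fun x hx => hx.2)
  filter_upwards [h2] with h hh
  simp only [Function.comp_apply]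
  rw [← smul_sub, ← key h hh, smul_mul_assoc, mul_assoc, hR, mul_one, ← Complex.ofReal_inv,
    Complex.coe_smul]

/-- In finite dimension, pointwise convergence of linear maps implies convergence in norm. -/
theorem tendsto_toContinuousLinearMap {B : Type*} [NormedAddCommGroup B] [NormedSpace ℂ B]
    [FiniteDimensional ℂ B] {α : Type*} {l : Filter α} {Λ : α → B →ₗ[ℂ] B} {Φ : B →ₗ[ℂ] B}
    (h : ∀ A, Tendsto (fun t => Λ t A) l (𝓝 (Φ A))) :
    Tendsto (fun t => LinearMap.toContinuousLinearMap (Λ t)) l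
      (𝓝 (LinearMap.toContinuousLinearMap Φ)) := by
  let b := Module.finBasis ℂ B
  -- A linear map is recovered linearly, hence continuously, from its values on a finite basis.
  let F : (Fin (Module.finrank ℂ B) → B) →ₗ[ℂ] (B →L[ℂ] B) :=
    (LinearMap.toContinuousLinearMap (𝕜 := ℂ) (E := B) (F' := B)).toLinearMap.comp
      (b.constr ℂ).toLinearMap
  have hF : ∀ Ψ : B →ₗ[ℂ] B, LinearMap.toContinuousLinearMap Ψ = F fun i => Ψ (b i) := by
    intro Ψ
    simp only [F, LinearMap.comp_apply, LinearEquiv.coe_coe]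
    congr 1
    exact b.ext fun i => by simp
  simp only [hF]
  exact ((LinearMap.continuous_of_finiteDimensional F).tendsto _).comp
    (tendsto_pi_nhds.2 fun i => h (b i))

/-- The semigroup, as a family of continuous linear maps. -/
noncomputable def toCLM {B : Type*} [NormedAddCommGroup B] [NormedSpace ℂ B]
    [FiniteDimensional ℂ B] (Λ : ℝ≥0 → B →ₗ[ℂ] B) (t : ℝ≥0) : B →L[ℂ] B :=
  LinearMap.toContinuousLinearMap (Λ t)

variable {H : Type*} [NormedAddCommGroup H] [InnerProductSpace ℂ H] [FiniteDimensional ℂ H]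

theorem IsOpSemigroup.exists_generator {Λ : ℝ≥0 → ((H →L[ℂ] H) →ₗ[ℂ] (H →L[ℂ] H))}
    (h : IsOpSemigroup Λ) : ∃ L : (H →L[ℂ] H) →L[ℂ] (H →L[ℂ] H),
      Tendsto (fun t : ℝ≥0 => ((t : ℝ) : ℂ)⁻¹ • (toCLM Λ t - 1)) (𝓝[>] 0) (𝓝 L) := by
  have : CompleteSpace H := FiniteDimensional.complete ℂ H
  refine GenTwirling.exists_generator (toCLM Λ) ?_ ?_ ?_
  · ext1 A; simp [toCLM, h.zero]
  · intro s t
    ext1 A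
    simp [toCLM, ← h.comp]
  · exact tendsto_toContinuousLinearMap (Φ := LinearMap.id) h.tendsto

end Generator

/-! ### Kossakowski's condition implies positivity -/

section Positivity

open InnerProductSpace

variable {H : Type*} [NormedAddCommGroup H] [InnerProductSpace ℂ H]

/-- The numerical range of `A` lies to the left of `c`. -/
def NumBound (A : H →L[ℂ] H) (c : ℝ) : Prop := ∀ x, (inner ℂ x (A x)).re ≤ c * ‖x‖ ^ 2

theorem NumBound.add_norm {A : H →L[ℂ] H} {c : ℝ} (hA : NumBound A c) (E : H →L[ℂ] H) :
    NumBound (A + E) (c + ‖E‖) := by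
  intro x
  have h1 : (inner ℂ x (E x)).re ≤ ‖E‖ * ‖x‖ ^ 2 := by
    calc (inner ℂ x (E x)).re ≤ ‖(inner ℂ x (E x) : ℂ)‖ := Complex.re_le_norm _
      _ ≤ ‖x‖ * ‖E x‖ := norm_inner_le_norm _ _
      _ ≤ ‖x‖ * (‖E‖ * ‖x‖) := by gcongr; exact E.le_opNorm x
      _ = ‖E‖ * ‖x‖ ^ 2 := by ring
  simp only [_root_.add_apply, inner_add_right, Complex.add_re, add_mul]
  exact add_le_add (hA x) h1

theorem NumBound.mono {A : H →L[ℂ] H} {c c' : ℝ} (hA : NumBound A c) (h : c ≤ c') :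
    NumBound A c' := fun x => (hA x).trans (by gcongr)

variable [FiniteDimensional ℂ H]

theorem eq_sum_eigenvalues {A : H →L[ℂ] H} (hA : (A : H →ₗ[ℂ] H).IsSymmetric) :
    A = ∑ i, (hA.eigenvalues rfl i : ℂ) •
      rankOne ℂ (hA.eigenvectorBasis rfl i) (hA.eigenvectorBasis rfl i) := by
  have h := op_eq_sum_rankOne (hA.eigenvectorBasis rfl) A
  have e : ∀ k, A (hA.eigenvectorBasis rfl k) =
      (hA.eigenvalues rfl k : ℂ) • hA.eigenvectorBasis rfl k := fun k =>
    hA.apply_eigenvectorBasis rfl k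
  conv_lhs => rw [h]
  refine Finset.sum_congr rfl fun j _ => ?_
  simp [e, orthonormal_iff_ite.1 (hA.eigenvectorBasis rfl).orthonormal]

/-- The dissipativity of `L`, expressed through the largest eigenvalue. -/
theorem NumBound.of_resolvent {L : (H →L[ℂ] H) →L[ℂ] (H →L[ℂ] H)} (hL1 : L 1 = 0)
    (hL : ∀ (ψ : OrthonormalBasis (Fin (Module.finrank ℂ H)) ℂ H) (j k), j ≠ k →
      0 ≤ (inner ℂ (ψ j) (L (rankOne ℂ (ψ k) (ψ k)) (ψ j))).re)
    {A : H →L[ℂ] H} (hA : (A : H →ₗ[ℂ] H).IsSymmetric) {h c : ℝ} (hh : 0 ≤ h)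
    (hb : NumBound (A - (h : ℂ) • L A) c) : NumBound A c := by
  intro x
  rcases isEmpty_or_nonempty (Fin (Module.finrank ℂ H)) with he | he
  · have : Module.finrank ℂ H = 0 := by
      by_contra h0
      exact he.false ⟨0, Nat.pos_of_ne_zero h0⟩
    have : Subsingleton H := Module.finrank_zero_iff.1 this
    simp [Subsingleton.elim x 0]
  set b := hA.eigenvectorBasis rfl
  set p := hA.eigenvalues rfl
  have hAs : A = ∑ i, (p i : ℂ) • rankOne ℂ (b i) (b i) := eq_sum_eigenvalues hA
  obtain ⟨m, hm⟩ := Finite.exists_max p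
  have hpm : p m ≤ c := by
    have h1 := hb (b m)
    have hAm : A (b m) = (p m : ℂ) • b m := hA.apply_eigenvectorBasis rfl m
    have hbm : inner ℂ (b m) (b m) = (1 : ℂ) := by
      simp [inner_self_eq_norm_sq_to_K]
    -- L kills 1, so A may be replaced by A − p_m 1. Its eigenvalues p_i − p_m are nonpositive, so
    -- the diagonal element of L A at the top eigenvector b_m is nonpositive.
    have h2 : L A = ∑ i, ((p i - p m : ℝ) : ℂ) • L (rankOne ℂ (b i) (b i)) := by
      have : A = (p m : ℂ) • 1 + ∑ i, ((p i - p m : ℝ) : ℂ) • rankOne ℂ (b i) (b i) := by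
        simp only [Complex.ofReal_sub, sub_smul, Finset.sum_sub_distrib, ← Finset.smul_sum,
          ← one_eq_sum_rankOne b, ← hAs]
        abel
      conv_lhs => rw [this]
      simp [hL1]
    have h3 : (inner ℂ (b m) (L A (b m))).re ≤ 0 := by
      rw [h2]
      simp only [_root_.sum_apply, _root_.smul_apply, inner_sum, inner_smul_right, Complex.re_sum,
        Complex.re_ofReal_mul]
      refine Finset.sum_nonpos fun i _ => ?_
      by_cases hi : m = i
      · simp [hi]
      · exact mul_nonpos_of_nonpos_of_nonneg (by linarith [hm i]) (hL b m i hi)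
    simp only [_root_.sub_apply, _root_.smul_apply, inner_sub_right, inner_smul_right, hAm, hbm,
      Complex.sub_re, Complex.re_ofReal_mul, b.norm_eq_one, mul_one, Complex.ofReal_re,
      one_pow] at h1
    nlinarith
  rw [← b.sum_sq_norm_inner_right x, Finset.mul_sum]
  conv_lhs => rw [hAs]
  simp only [_root_.sum_apply, _root_.smul_apply, inner_sum, inner_smul_right, Complex.re_sum,
    Complex.re_ofReal_mul, rankOne_apply]
  refine Finset.sum_le_sum fun i _ => ?_
  have e : (inner ℂ (b i) x * inner ℂ x (b i)).re = ‖inner ℂ (b i) x‖ ^ 2 := by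
    rw [← RCLike.re_to_complex, inner_mul_symm_re_eq_norm, norm_mul, norm_inner_symm x (b i), ← sq]
  rw [e]
  gcongr
  exact (hm i).trans hpm

variable {Λ : ℝ≥0 → ((H →L[ℂ] H) →ₗ[ℂ] (H →L[ℂ] H))}

theorem toCLM_apply (t : ℝ≥0) (A : H →L[ℂ] H) : toCLM Λ t A = Λ t A := rfl

theorem IsOpSemigroup.tendsto_generator_apply
    {L : (H →L[ℂ] H) →L[ℂ] (H →L[ℂ] H)}
    (hL : Tendsto (fun t : ℝ≥0 => ((t : ℝ) : ℂ)⁻¹ • (toCLM Λ t - 1)) (𝓝[>] 0) (𝓝 L))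
    (A : H →L[ℂ] H) :
    Tendsto (fun t : ℝ≥0 => ((t : ℝ) : ℂ)⁻¹ • (Λ t A - A)) (𝓝[>] 0) (𝓝 (L A)) :=
  (((ContinuousLinearMap.apply ℂ (H →L[ℂ] H) A).continuous.tendsto L).comp hL :)

/-- The second bound says that X = Λ_h Y solves the implicit Euler equation X − hLX = Y up to o(h),
because (Λ_h − 1)/h and L Λ_h have the same limit L. The first keeps the iterates bounded. -/
theorem IsOpSemigroup.eventually_step (hΛ : IsOpSemigroup Λ)
    {L : (H →L[ℂ] H) →L[ℂ] (H →L[ℂ] H)}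
    (hL : Tendsto (fun t : ℝ≥0 => ((t : ℝ) : ℂ)⁻¹ • (toCLM Λ t - 1)) (𝓝[>] 0) (𝓝 L))
    {ε : ℝ} (hε : 0 < ε) : ∀ᶠ h in 𝓝[>] (0 : ℝ≥0), ∀ Y : H →L[ℂ] H,
      ‖Λ h Y‖ ≤ (1 + h * (‖L‖ + 1)) * ‖Y‖ ∧
      ‖Λ h Y - ((h : ℝ) : ℂ) • L (Λ h Y) - Y‖ ≤ h * ε * ‖Y‖ := by
  have hT : Tendsto (toCLM Λ) (𝓝[>] 0) (𝓝 1) :=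
    tendsto_toContinuousLinearMap (Φ := LinearMap.id) hΛ.tendsto
  have h1 : ∀ᶠ h : ℝ≥0 in 𝓝[>] 0, ‖((h : ℝ) : ℂ)⁻¹ • (toCLM Λ h - 1)‖ ≤ ‖L‖ + 1 :=
    hL.norm.eventually (eventually_le_nhds (by linarith))
  have h2 : ∀ᶠ h : ℝ≥0 in 𝓝[>] 0,
      ‖((h : ℝ) : ℂ)⁻¹ • (toCLM Λ h - 1) - L * toCLM Λ h‖ ≤ ε := by
    have hTL : Tendsto (fun h => L * toCLM Λ h) (𝓝[>] 0) (𝓝 (L * 1)) :=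
      ((ContinuousLinearMap.compL ℂ _ _ _ L).continuous.tendsto 1).comp hT
    rw [mul_one] at hTL
    have := (hL.sub hTL).norm
    rw [sub_self, norm_zero] at this
    exact this.eventually (eventually_le_nhds hε)
  filter_upwards [h1, h2, self_mem_nhdsWithin] with h h1 h2 h0 Y
  have h0' : (0 : ℝ) < h := h0
  have h0C : ((h : ℝ) : ℂ) ≠ 0 := by exact_mod_cast h0'.ne'
  have hn : ‖((h : ℝ) : ℂ)‖ = h := by simp
  constructor
  · have e : Λ h Y = Y + ((h : ℝ) : ℂ) • (((h : ℝ) : ℂ)⁻¹ • (toCLM Λ h - 1)) Y := by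
      rw [_root_.smul_apply, smul_smul, mul_inv_cancel₀ h0C, one_smul, _root_.sub_apply,
        toCLM_apply]
      simp
    rw [e]
    refine (norm_add_le _ _).trans ?_
    rw [norm_smul, hn, add_mul, one_mul, mul_assoc]
    gcongr
    exact (ContinuousLinearMap.le_opNorm _ _).trans (by gcongr)
  · have e : Λ h Y - ((h : ℝ) : ℂ) • L (Λ h Y) - Y =
        ((h : ℝ) : ℂ) • (((h : ℝ) : ℂ)⁻¹ • (toCLM Λ h - 1) - L * toCLM Λ h) Y := by
      rw [_root_.sub_apply, _root_.smul_apply, smul_sub, smul_smul, mul_inv_cancel₀ h0C, one_smul,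
        _root_.sub_apply, mul_apply_eq_comp, toCLM_apply]
      rw [show (1 : (H →L[ℂ] H) →L[ℂ] (H →L[ℂ] H)) Y = Y from rfl]
      abel
    rw [e, norm_smul, hn, mul_assoc]
    gcongr
    exact (ContinuousLinearMap.le_opNorm _ _).trans (by gcongr)

variable [CompleteSpace H]

/-- An implicit Euler argument: in each of n steps of length h = T/n the resolvent bound preserves c
and the error adds at most hε‖Λ_{kh} A‖. The accumulated error is of order ε, which is arbitrary. -/
theorem NumBound.semigroup (hΛ : IsOpSemigroup Λ)
    (hstar : ∀ t A, Λ t (star A) = star (Λ t A))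
    {L : (H →L[ℂ] H) →L[ℂ] (H →L[ℂ] H)}
    (hlim : Tendsto (fun t : ℝ≥0 => ((t : ℝ) : ℂ)⁻¹ • (toCLM Λ t - 1)) (𝓝[>] 0) (𝓝 L))
    (hL1 : L 1 = 0)
    (hL : ∀ (ψ : OrthonormalBasis (Fin (Module.finrank ℂ H)) ℂ H) (j k), j ≠ k →
      0 ≤ (inner ℂ (ψ j) (L (rankOne ℂ (ψ k) (ψ k)) (ψ j))).re)
    {A : H →L[ℂ] H} (hA : IsSelfAdjoint A) {c : ℝ} (hb : NumBound A c) (T : ℝ≥0) :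
    NumBound (Λ T A) c := by
  have key : ∀ ε > 0, NumBound (Λ T A)
      (c + T * ε * (Real.exp (T * (‖L‖ + 1)) * ‖A‖)) := by
    intro ε hε
    obtain ⟨δ, hδ, hstep⟩ := eventually_nhdsGT_zero_nnreal (hΛ.eventually_step hlim hε)
    rcases eq_or_ne T 0 with rfl | hT0
    · simpa [hΛ.zero] using hb
    obtain ⟨n, hn⟩ := exists_nat_gt (T / δ)
    have hn0 : 0 < (n : ℝ≥0) := pos_of_gt hn
    set h : ℝ≥0 := T / n with hh
    have hh0 : 0 < h := div_pos (pos_iff_ne_zero.2 hT0) hn0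
    have hhδ : h < δ := by
      rw [hh, div_lt_iff₀ hn0, mul_comm]; exact (div_lt_iff₀ hδ).1 hn
    have hnh : (n : ℝ) * h = T := by
      have : (n : ℝ≥0) * h = T := mul_div_cancel₀ _ hn0.ne'
      exact_mod_cast congrArg ((↑) : ℝ≥0 → ℝ) this
    set K := ‖L‖ + 1
    have hK : 0 ≤ K := by positivity
    have hsucc : ∀ k : ℕ, Λ ((k + 1 : ℕ) * h) A = Λ h (Λ (k * h) A) := by
      intro k
      rw [← LinearMap.comp_apply, hΛ.comp]
      congr 2
      push_cast
      ring
    have hnorm : ∀ k : ℕ, ‖Λ (k * h) A‖ ≤ Real.exp (k * h * K) * ‖A‖ := by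
      intro k
      induction k with
      | zero => simp [hΛ.zero]
      | succ k ih =>
        rw [hsucc]
        refine ((hstep h hh0 hhδ _).1).trans ?_
        have e1 : 1 + h * K ≤ Real.exp (h * K) := by linarith [Real.add_one_le_exp ((h : ℝ) * K)]
        calc (1 + h * K) * ‖Λ (k * h) A‖
            ≤ Real.exp (h * K) * (Real.exp (k * h * K) * ‖A‖) := by gcongr
          _ = Real.exp (((k + 1 : ℕ) : ℝ) * h * K) * ‖A‖ := by
            rw [← mul_assoc, ← Real.exp_add]; push_cast; ring_nf
    have hsa : ∀ t, IsSelfAdjoint (Λ t A) := fun t => by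
      rw [IsSelfAdjoint, ← hstar, hA.star_eq]
    have hind : ∀ k : ℕ, k ≤ n → NumBound (Λ (k * h) A)
        (c + k * (h * ε * (Real.exp (T * K) * ‖A‖))) := by
      intro k
      induction k with
      | zero => intro _; simpa [hΛ.zero] using hb
      | succ k ih =>
        intro hk
        rw [hsucc]
        have hprev := ih (by omega)
        have herr := (hstep h hh0 hhδ (Λ (k * h) A)).2
        have hX : IsSelfAdjoint (Λ h (Λ (k * h) A)) := by rw [← hsucc]; exact hsa _
        have hexp : Real.exp (k * h * K) ≤ Real.exp (T * K) := by
          rw [← hnh]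
          have : (k : ℝ) ≤ n := by exact_mod_cast (by omega : k ≤ n)
          gcongr
        -- For the next iterate X, the operator X − hLX is the previous iterate plus the small
        -- error, so its bound is the previous one increased by the norm of that error.
        refine NumBound.of_resolvent hL1 hL hX.isSymmetric (h := h) h.coe_nonneg ?_
        have := hprev.add_norm (Λ h (Λ (k * h) A) - ((h : ℝ) : ℂ) • L (Λ h (Λ (k * h) A)) -
          Λ (k * h) A)
        rw [add_sub_cancel] at this
        refine this.mono ?_
        have e2 : h * ε * ‖Λ (k * h) A‖ ≤ h * ε * (Real.exp (T * K) * ‖A‖) := by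
          have := hnorm k
          gcongr
          exact this.trans (by gcongr)
        push_cast
        linarith
    have := hind n le_rfl
    have e3 : (n : ℝ≥0) * h = T := mul_div_cancel₀ _ hn0.ne'
    rw [e3] at this
    refine this.mono (le_of_eq ?_)
    rw [← hnh]; ring
  intro x
  have hlim' : Tendsto (fun ε : ℝ => (c + T * ε * (Real.exp (T * (‖L‖ + 1)) * ‖A‖)) * ‖x‖ ^ 2)
      (𝓝[>] 0) (𝓝 (c * ‖x‖ ^ 2)) := by
    have : Continuous
        (fun ε : ℝ => (c + T * ε * (Real.exp (T * (‖L‖ + 1)) * ‖A‖)) * ‖x‖ ^ 2) := by fun_prop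
    simpa using (this.tendsto 0).mono_left nhdsWithin_le_nhds
  refine ge_of_tendsto hlim' ?_
  filter_upwards [self_mem_nhdsWithin] with ε hε
  exact key ε hε x

/-- A unital semigroup of adjoint-preserving maps whose generator satisfies Kossakowski's
condition consists of positive maps. -/
theorem isPositiveMap_of_generator (hΛ : IsOpSemigroup Λ)
    (hstar : ∀ t A, Λ t (star A) = star (Λ t A)) (hu : ∀ t, IsUnital (Λ t))
    {L : (H →L[ℂ] H) →L[ℂ] (H →L[ℂ] H)}
    (hlim : Tendsto (fun t : ℝ≥0 => ((t : ℝ) : ℂ)⁻¹ • (toCLM Λ t - 1)) (𝓝[>] 0) (𝓝 L))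
    (hL : ∀ (ψ : OrthonormalBasis (Fin (Module.finrank ℂ H)) ℂ H) (j k), j ≠ k →
      0 ≤ (inner ℂ (ψ j) (L (rankOne ℂ (ψ k) (ψ k)) (ψ j))).re) (t : ℝ≥0) :
    IsPositiveMap (Λ t) := by
  have hL1 : L 1 = 0 := by
    have h1 := IsOpSemigroup.tendsto_generator_apply hlim 1
    have h2 : ∀ t : ℝ≥0, ((t : ℝ) : ℂ)⁻¹ • (Λ t 1 - 1) = 0 := fun t => by
      rw [show Λ t 1 = 1 from hu t]; simp
    simp only [h2] at h1
    exact tendsto_nhds_unique h1 tendsto_const_nhds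
  intro A hA
  -- Positivity of A is the upper bound 0 for −A.
  have hb : NumBound (-A) 0 := fun x => by
    have := hA.re_inner_nonneg_right x
    simp only [RCLike.re_to_complex] at this
    simpa using this
  have h1 := hb.semigroup hΛ hstar hlim hL1 hL hA.isSelfAdjoint.neg t
  rw [map_neg] at h1
  have hsa : IsSelfAdjoint (Λ t A) := by rw [IsSelfAdjoint, ← hstar, hA.isSelfAdjoint.star_eq]
  refine (ContinuousLinearMap.isPositive_def').2 ⟨hsa, fun x => ?_⟩
  have := h1 x
  simp only [_root_.neg_apply, inner_neg_right, Complex.neg_re, zero_mul] at this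
  rw [ContinuousLinearMap.reApplyInnerSelf_apply, ← inner_re_symm]
  simp only [RCLike.re_to_complex]
  linarith

end Positivity

/-! ### Entropies and doubly stochastic matrices -/

section Majorization

open InnerProductSpace

variable {H : Type*} [NormedAddCommGroup H] [InnerProductSpace ℂ H]
  [FiniteDimensional ℂ H]

/-- The orthonormal basis of eigenvectors of a density operator. -/
noncomputable def DensityOp.eigenbasis (ρ : DensityOp H) :
    OrthonormalBasis (Fin (Module.finrank ℂ H)) ℂ H :=
  ρ.isPositive.isSymmetric.eigenvectorBasis rfl

theorem DensityOp.op_eigenbasis (ρ : DensityOp H) (k) :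
    ρ.op (ρ.eigenbasis k) = (ρ.eigenvalues k : ℂ) • ρ.eigenbasis k :=
  ρ.isPositive.isSymmetric.apply_eigenvectorBasis rfl k

theorem DensityOp.op_eq_sum (ρ : DensityOp H) :
    ρ.op = ∑ k, (ρ.eigenvalues k : ℂ) • rankOne ℂ (ρ.eigenbasis k) (ρ.eigenbasis k) :=
  eq_sum_eigenvalues ρ.isPositive.isSymmetric

theorem DensityOp.eigenvalues_eq_inner (ρ : DensityOp H) (k) :
    ρ.eigenvalues k = (inner ℂ (ρ.eigenbasis k) (ρ.op (ρ.eigenbasis k))).re := by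
  rw [ρ.op_eigenbasis, inner_smul_right, inner_self_eq_norm_sq_to_K, ρ.eigenbasis.norm_eq_one]
  simp

theorem DensityOp.eigenvalues_nonneg (ρ : DensityOp H) (k) : 0 ≤ ρ.eigenvalues k := by
  rw [ρ.eigenvalues_eq_inner]
  exact ρ.isPositive.re_inner_nonneg_right _

theorem DensityOp.sum_eigenvalues (ρ : DensityOp H) : ∑ k, ρ.eigenvalues k = 1 := by
  have h := ρ.trace_eq_one
  rw [opTrace_eq_sum_inner _ ρ.eigenbasis] at h
  simp only [ρ.eigenvalues_eq_inner, ← Complex.re_sum, h, Complex.one_re]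

/-- A positive, trace-preserving, unital map acts on eigenvalues by a doubly stochastic matrix. -/
theorem exists_doublyStochastic {Φ : (H →L[ℂ] H) →ₗ[ℂ] (H →L[ℂ] H)} (hpos : IsPositiveMap Φ)
    (htr : IsTracePreserving Φ) (hu : IsUnital Φ) (ρ : DensityOp H) :
    ∃ D ∈ doublyStochastic ℝ (Fin (Module.finrank ℂ H)),
      ∀ j, (ρ.map Φ hpos htr).eigenvalues j = ∑ k, D j k * ρ.eigenvalues k := by
  set ρ' := ρ.map Φ hpos htr
  let b := ρ.eigenbasis
  let b' := ρ'.eigenbasis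
  -- Positivity makes the entries nonnegative, unitality gives the row sums, and trace preservation
  -- the column sums.
  refine ⟨Matrix.of fun j k => (inner ℂ (b' j) (Φ (rankOne ℂ (b k) (b k)) (b' j))).re,
    mem_doublyStochastic_iff_sum.2 ⟨fun j k => ?_, fun j => ?_, fun k => ?_⟩, fun j => ?_⟩
  · exact (hpos _ (isPositive_rankOne_self (b k))).re_inner_nonneg_right _
  · simp only [Matrix.of_apply]
    rw [← Complex.re_sum, ← inner_sum, ← _root_.sum_apply, ← map_sum, ← one_eq_sum_rankOne b,
      show Φ 1 = 1 from hu]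
    simp [inner_self_eq_norm_sq_to_K]
  · simp only [Matrix.of_apply]
    rw [← Complex.re_sum, ← opTrace_eq_sum_inner, htr, opTrace_rankOne,
      inner_self_eq_norm_sq_to_K, b.norm_eq_one]
    simp
  · have h : ρ'.op = ∑ k, (ρ.eigenvalues k : ℂ) • Φ (rankOne ℂ (b k) (b k)) := by
      change Φ ρ.op = _
      conv_lhs => rw [ρ.op_eq_sum]
      simp [b]
    rw [ρ'.eigenvalues_eq_inner]
    change (inner ℂ (b' j) (ρ'.op (b' j))).re = _
    rw [h]
    simp only [_root_.sum_apply, _root_.smul_apply, inner_sum, inner_smul_right, Complex.re_sum,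
      Complex.re_ofReal_mul, Matrix.of_apply]
    exact Finset.sum_congr rfl fun k _ => mul_comm _ _

theorem sum_convex_le_of_doublyStochastic {n : ℕ} {D : Matrix (Fin n) (Fin n) ℝ}
    (hD : D ∈ doublyStochastic ℝ (Fin n)) {f : ℝ → ℝ} (hf : ConvexOn ℝ (Set.Ici 0) f)
    {p p' : Fin n → ℝ} (hp : ∀ k, 0 ≤ p k) (h : ∀ j, p' j = ∑ k, D j k * p k) :
    ∑ j, f (p' j) ≤ ∑ k, f (p k) := by
  rw [mem_doublyStochastic_iff_sum] at hD
  calc ∑ j, f (p' j) ≤ ∑ j, ∑ k, D j k * f (p k) := by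
        refine Finset.sum_le_sum fun j _ => ?_
        rw [h j]
        exact hf.map_sum_le (fun k _ => hD.1 j k) (hD.2.1 j) (fun k _ => hp k)
    _ = ∑ k, f (p k) := by
        rw [Finset.sum_comm]
        refine Finset.sum_congr rfl fun k _ => ?_
        rw [← Finset.sum_mul, hD.2.2 k, one_mul]

variable (H) in
/-- The completely mixed state. -/
noncomputable def mixedState (hd : 2 ≤ Module.finrank ℂ H) : DensityOp H where
  op := (((Module.finrank ℂ H : ℝ)⁻¹ : ℝ) : ℂ) • 1
  isPositive := ContinuousLinearMap.isPositive_one.smul_of_nonneg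
    (Complex.zero_le_real.2 (by positivity))
  trace_eq_one := by
    rw [opTrace_smul, opTrace_one]
    push_cast
    exact inv_mul_cancel₀ (Nat.cast_ne_zero.2 (by omega))

theorem mixedState_eigenvalues (hd : 2 ≤ Module.finrank ℂ H) (k) :
    (mixedState H hd).eigenvalues k = (Module.finrank ℂ H : ℝ)⁻¹ := by
  rw [DensityOp.eigenvalues_eq_inner]
  simp [mixedState, inner_self_eq_norm_sq_to_K]

theorem DensityOp.op_eq_mixed (hd : 2 ≤ Module.finrank ℂ H) {ρ : DensityOp H}
    (h : ∀ k, ρ.eigenvalues k = (Module.finrank ℂ H : ℝ)⁻¹) : ρ.op = (mixedState H hd).op := by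
  rw [ρ.op_eq_sum]
  simp only [h, ← Finset.smul_sum, ← one_eq_sum_rankOne]
  rfl

/-- The mean of the p k is 1/n, so the hypothesis reverses Jensen's inequality with uniform weights;
strict convexity then makes p constant. -/
theorem eq_inv_of_sum_strictConvex_le {n : ℕ} (hn : 0 < n) {f : ℝ → ℝ}
    (hf : StrictConvexOn ℝ (Set.Ici 0) f) {p : Fin n → ℝ} (hp : ∀ k, 0 ≤ p k)
    (hs : ∑ k, p k = 1) (h : ∑ k, f (p k) ≤ ∑ _k : Fin n, f (n : ℝ)⁻¹) (k : Fin n) :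
    p k = (n : ℝ)⁻¹ := by
  have hn' : (0 : ℝ) < n := Nat.cast_pos.2 hn
  have hall := hf.eq_of_le_map_sum (t := Finset.univ) (w := fun _ => (n : ℝ)⁻¹) (p := p)
    (fun _ _ => by positivity) (by simp [hn'.ne']) (fun k _ => hp k) (by
      simp only [smul_eq_mul, ← Finset.mul_sum, hs, mul_one]
      simp only [Finset.sum_const, Finset.card_univ, Fintype.card_fin, nsmul_eq_mul] at h
      rw [inv_mul_le_iff₀ hn']
      exact h)
  have : ∑ j, p j = ∑ _j : Fin n, p k :=
    Finset.sum_congr rfl fun j _ => hall (Finset.mem_univ _) (Finset.mem_univ _)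
  rw [hs] at this
  simp only [Finset.sum_const, Finset.card_univ, Fintype.card_fin, nsmul_eq_mul] at this
  exact eq_inv_of_mul_eq_one_right this.symm

theorem DensityOp.sum_rpow_pos (ρ : DensityOp H) (q : ℝ) : 0 < ∑ k, ρ.eigenvalues k ^ q := by
  obtain ⟨k, hk⟩ : ∃ k, 0 < ρ.eigenvalues k := by
    by_contra! hcon
    have := Finset.sum_nonpos (s := Finset.univ) (fun k _ => hcon k)
    rw [ρ.sum_eigenvalues] at this
    linarith
  exact Finset.sum_pos' (fun k _ => Real.rpow_nonneg (ρ.eigenvalues_nonneg k) q)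
    ⟨k, Finset.mem_univ k, Real.rpow_pos_of_pos hk q⟩

theorem DensityOp.eigenvalues_le_norm (ρ : DensityOp H) (k) : ρ.eigenvalues k ≤ ‖ρ.op‖ := by
  have h := ρ.op.le_opNorm (ρ.eigenbasis k)
  rw [ρ.op_eigenbasis, norm_smul, ρ.eigenbasis.norm_eq_one, mul_one, mul_one, Complex.norm_real,
    Real.norm_of_nonneg (ρ.eigenvalues_nonneg k)] at h
  exact h

theorem DensityOp.norm_le (ρ : DensityOp H) {c : ℝ} (hc : 0 ≤ c)
    (h : ∀ k, ρ.eigenvalues k ≤ c) : ‖ρ.op‖ ≤ c := by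
  refine ρ.op.opNorm_le_bound hc fun x => ?_
  refine le_of_sq_le_sq ?_ (by positivity)
  rw [mul_pow, ← ρ.eigenbasis.sum_sq_norm_inner_right x,
    ← ρ.eigenbasis.sum_sq_norm_inner_right (ρ.op x), Finset.mul_sum]
  refine Finset.sum_le_sum fun k _ => ?_
  have : inner ℂ (ρ.eigenbasis k) (ρ.op x) =
      (ρ.eigenvalues k : ℂ) * inner ℂ (ρ.eigenbasis k) x := by
    rw [← ρ.isPositive.inner_left_eq_inner_right, ρ.op_eigenbasis, inner_smul_left,
      Complex.conj_ofReal]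
  rw [this, norm_mul, mul_pow, Complex.norm_real, Real.norm_of_nonneg (ρ.eigenvalues_nonneg k)]
  have := h k
  have := ρ.eigenvalues_nonneg k
  gcongr

/-- All the entropies but `1 - ‖·‖_∞` are decreasing functions of `tr (f ρ)` with `f` strictly
convex. -/
theorem IsQuantumEntropy.le_iff {E : DensityOp H → ℝ} (hE : IsQuantumEntropy E) :
    (∃ f : ℝ → ℝ, StrictConvexOn ℝ (Set.Ici 0) f ∧ ∀ ρ ρ' : DensityOp H,
      E ρ ≤ E ρ' ↔ ∑ k, f (ρ'.eigenvalues k) ≤ ∑ k, f (ρ.eigenvalues k)) ∨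
    ∀ ρ ρ' : DensityOp H, E ρ ≤ E ρ' ↔ ‖ρ'.op‖ ≤ ‖ρ.op‖ := by
  have hvN : ∃ f : ℝ → ℝ, StrictConvexOn ℝ (Set.Ici 0) f ∧ ∀ ρ ρ' : DensityOp H,
      vonNeumannEntropy ρ ≤ vonNeumannEntropy ρ' ↔
        ∑ k, f (ρ'.eigenvalues k) ≤ ∑ k, f (ρ.eigenvalues k) :=
    ⟨fun x => x * Real.log x, Real.strictConvexOn_mul_log, fun ρ ρ' => by
      simp [vonNeumannEntropy]⟩
  cases hE with
  | tsallis q hq =>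
    left
    rcases lt_trichotomy q 1 with h | rfl | h
    -- For q < 1 the power is concave and the prefactor positive; for q > 1 both signs flip, so the
    -- order is reversed in either case.
    · refine ⟨fun x => -x ^ q, (Real.strictConcaveOn_rpow hq h).neg, fun ρ ρ' => ?_⟩
      have : 0 < 1 / (1 - q) := one_div_pos.2 (by linarith)
      simp only [tsallisEntropy, if_neg h.ne, mul_le_mul_iff_right₀ this, Finset.sum_neg_distrib,
        neg_le_neg_iff, sub_le_sub_iff_right]
    · simpa [tsallisEntropy] using hvN
    · refine ⟨fun x => x ^ q, strictConvexOn_rpow h, fun ρ ρ' => ?_⟩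
      have : 1 / (1 - q) < 0 := one_div_neg.2 (by linarith)
      simp only [tsallisEntropy, if_neg h.ne', mul_le_mul_left_of_neg this, sub_le_sub_iff_right]
  | renyi q hq =>
    left
    rcases lt_trichotomy q 1 with h | rfl | h
    · refine ⟨fun x => -x ^ q, (Real.strictConcaveOn_rpow hq h).neg, fun ρ ρ' => ?_⟩
      have : 0 < 1 / (1 - q) := one_div_pos.2 (by linarith)
      simp only [renyiEntropy, if_neg h.ne, mul_le_mul_iff_right₀ this, Finset.sum_neg_distrib,
        neg_le_neg_iff, Real.log_le_log_iff (ρ.sum_rpow_pos q) (ρ'.sum_rpow_pos q)]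
    · simpa [renyiEntropy] using hvN
    · refine ⟨fun x => x ^ q, strictConvexOn_rpow h, fun ρ ρ' => ?_⟩
      have : 1 / (1 - q) < 0 := one_div_neg.2 (by linarith)
      simp only [renyiEntropy, if_neg h.ne', mul_le_mul_left_of_neg this,
        Real.log_le_log_iff (ρ'.sum_rpow_pos q) (ρ.sum_rpow_pos q)]
  | schatten p hp =>
    rcases eq_or_ne p ∞ with rfl | hp'
    · right
      intro ρ ρ'
      simp only [schattenEntropy, if_true, sub_le_sub_iff_left]
    · left
      have h1 : 1 < p.toReal := by
        rw [← ENNReal.toReal_one]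
        exact (ENNReal.toReal_lt_toReal ENNReal.one_ne_top hp').2 hp
      refine ⟨fun x => x ^ p.toReal, strictConvexOn_rpow h1, fun ρ ρ' => ?_⟩
      simp only [schattenEntropy, if_neg hp', sub_le_sub_iff_left]
      exact Real.rpow_le_rpow_iff (ρ'.sum_rpow_pos _).le (ρ.sum_rpow_pos _).le
        (one_div_pos.2 (by linarith))

theorem IsQuantumEntropy.le_map {E : DensityOp H → ℝ} (hE : IsQuantumEntropy E)
    {Φ : (H →L[ℂ] H) →ₗ[ℂ] (H →L[ℂ] H)} (hpos : IsPositiveMap Φ)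
    (htr : IsTracePreserving Φ) (hu : IsUnital Φ) (ρ : DensityOp H) :
    E ρ ≤ E (ρ.map Φ hpos htr) := by
  obtain ⟨D, hD, h⟩ := exists_doublyStochastic hpos htr hu ρ
  rcases hE.le_iff with ⟨f, hf, hiff⟩ | hiff
  · rw [hiff]
    exact sum_convex_le_of_doublyStochastic hD hf.convexOn ρ.eigenvalues_nonneg h
  · rw [hiff]
    refine DensityOp.norm_le _ (norm_nonneg _) fun j => ?_
    rw [mem_doublyStochastic_iff_sum] at hD
    rw [h]
    calc ∑ k, D j k * ρ.eigenvalues k ≤ ∑ k, D j k * ‖ρ.op‖ :=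
          Finset.sum_le_sum fun k _ =>
            mul_le_mul_of_nonneg_left (ρ.eigenvalues_le_norm k) (hD.1 j k)
      _ = ‖ρ.op‖ := by rw [← Finset.sum_mul, hD.2.1 j, one_mul]

/-- The completely mixed state is the only state of maximal entropy. -/
theorem IsQuantumEntropy.eq_mixed {E : DensityOp H → ℝ} (hE : IsQuantumEntropy E)
    (hd : 2 ≤ Module.finrank ℂ H) {ρ : DensityOp H} (h : E (mixedState H hd) ≤ E ρ) :
    ρ.op = (mixedState H hd).op := by
  refine DensityOp.op_eq_mixed hd fun k => ?_
  rcases hE.le_iff with ⟨f, hf, hiff⟩ | hiff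
  · rw [hiff] at h
    simp only [mixedState_eigenvalues] at h
    exact eq_inv_of_sum_strictConvex_le (by omega) hf ρ.eigenvalues_nonneg ρ.sum_eigenvalues h k
  · rw [hiff] at h
    have h1 : ‖(mixedState H hd).op‖ ≤ (Module.finrank ℂ H : ℝ)⁻¹ :=
      DensityOp.norm_le _ (by positivity) fun k => (mixedState_eigenvalues hd k).le
    -- The operator norm is not strictly convex in the eigenvalues; instead, d numbers at most 1/d
    -- with sum 1 all equal 1/d.
    have h2 : ∀ k, ρ.eigenvalues k ≤ (Module.finrank ℂ H : ℝ)⁻¹ := fun k =>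
      (ρ.eigenvalues_le_norm k).trans (h.trans h1)
    have h3 : ∑ k, ρ.eigenvalues k = ∑ _k : Fin (Module.finrank ℂ H),
        (Module.finrank ℂ H : ℝ)⁻¹ := by
      rw [ρ.sum_eigenvalues]
      have : (Module.finrank ℂ H : ℝ) ≠ 0 := Nat.cast_ne_zero.2 (by omega)
      simp [this]
    exact (Finset.sum_eq_sum_iff_of_le fun k _ => h2 k).1 h3 k (Finset.mem_univ k)

variable {Λ : ℝ≥0 → ((H →L[ℂ] H) →ₗ[ℂ] (H →L[ℂ] H))}

/-- Evolving the completely mixed state from time 0 cannot lower its maximal entropy, so uniqueness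
of the maximizer makes it a fixed point. -/
theorem IsQuantumEntropy.doesNotDecrease_iff {E : DensityOp H → ℝ} (hE : IsQuantumEntropy E)
    (hd : 2 ≤ Module.finrank ℂ H) (hΛ : IsPTPSemigroup Λ) :
    DoesNotDecrease hΛ E ↔ ∀ t, IsUnital (Λ t) := by
  constructor
  · intro h t
    have h1 := h (mixedState H hd) 0 t
    have e0 : (mixedState H hd).map (Λ 0) (hΛ.positive 0) (hΛ.tracePreserving 0) =
        mixedState H hd := by
      simp [DensityOp.map, hΛ.zero]
    simp only [e0, zero_add] at h1
    have h2 := hE.eq_mixed hd h1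
    simp only [DensityOp.map, mixedState, map_smul] at h2
    have hne : (((Module.finrank ℂ H : ℝ)⁻¹ : ℝ) : ℂ) ≠ 0 := by
      push_cast
      exact inv_ne_zero (Nat.cast_ne_zero.2 (by omega))
    exact smul_right_injective _ hne h2
  · intro hu ρ t s
    have h := hE.le_map (hΛ.positive s) (hΛ.tracePreserving s) (hu s)
      (ρ.map (Λ t) (hΛ.positive t) (hΛ.tracePreserving t))
    have e : (ρ.map (Λ t) (hΛ.positive t) (hΛ.tracePreserving t)).map (Λ s) (hΛ.positive s)
        (hΛ.tracePreserving s) =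
        ρ.map (Λ (t + s)) (hΛ.positive (t + s)) (hΛ.tracePreserving (t + s)) := by
      simp only [DensityOp.map, DensityOp.mk.injEq]
      rw [add_comm t s, ← hΛ.comp, LinearMap.comp_apply]
    rwa [e] at h

end Majorization

/-! ### Twirling conditions versus semigroup properties -/

section Conditions

open InnerProductSpace

variable {H : Type*} [NormedAddCommGroup H] [InnerProductSpace ℂ H] [CompleteSpace H]
  [FiniteDimensional ℂ H]
variable {G : Type*} [Group G] [TopologicalSpace G] [SecondCountableTopology G]
  [MeasurableSpace G] [BorelSpace G]
  {π : G →* unitary (H →L[ℂ] H)} (hπ : Continuous π) {σ : ℝ≥0 → SignedMeasure G}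

omit [CompleteSpace H] [FiniteDimensional ℂ H] in
theorem ext_inner_basis {ι : Type*} [Fintype ι] (ψ : OrthonormalBasis ι ℂ H) {A B : H →L[ℂ] H}
    (h : ∀ j m, inner ℂ (ψ j) (A (ψ m)) = inner ℂ (ψ j) (B (ψ m))) : A = B := by
  rw [op_eq_sum_rankOne ψ A, op_eq_sum_rankOne ψ B]
  simp only [h]

omit [CompleteSpace H] [FiniteDimensional ℂ H] in
theorem tendsto_of_inner_basis {ι α : Type*} [Fintype ι] (ψ : OrthonormalBasis ι ℂ H)
    {l : Filter α} {F : α → H →L[ℂ] H} {B : H →L[ℂ] H}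
    (h : ∀ j m, Tendsto (fun t => inner ℂ (ψ j) (F t (ψ m))) l (𝓝 (inner ℂ (ψ j) (B (ψ m))))) :
    Tendsto F l (𝓝 B) := by
  have e : F = fun t => ∑ j, ∑ k, inner ℂ (ψ j) (F t (ψ k)) • rankOne ℂ (ψ j) (ψ k) :=
    funext fun t => op_eq_sum_rankOne ψ (F t)
  rw [e, op_eq_sum_rankOne ψ B]
  exact tendsto_finsetSum _ fun j _ => tendsto_finsetSum _ fun k _ => (h j k).smul_const _

omit [CompleteSpace H] [FiniteDimensional ℂ H] in
theorem tendsto_inner_apply {α : Type*} {l : Filter α} {F : α → H →L[ℂ] H} {B : H →L[ℂ] H}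
    (h : Tendsto F l (𝓝 B)) (x y : H) :
    Tendsto (fun t => inner ℂ x (F t y)) l (𝓝 (inner ℂ x (B y))) :=
  ((((innerSL ℂ x).comp (ContinuousLinearMap.apply ℂ H y)).continuous.tendsto B).comp h :)

omit [CompleteSpace H] [FiniteDimensional ℂ H] in
theorem inner_rankOne_basis {ι : Type*} [Fintype ι] [DecidableEq ι] (ψ : OrthonormalBasis ι ℂ H)
    (j k l m : ι) : inner ℂ (ψ j) (rankOne ℂ (ψ k) (ψ l) (ψ m)) =
      ((if j = k then 1 else 0) * (if l = m then 1 else 0) : ℂ) := by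
  rw [inner_right_rankOne_apply, orthonormal_iff_ite.1 ψ.orthonormal,
    orthonormal_iff_ite.1 ψ.orthonormal]

/-- Twirling by a signed measure, as a linear map. -/
noncomputable def twirlₗ (hπ : Continuous π) (σ : SignedMeasure G) :
    (H →L[ℂ] H) →ₗ[ℂ] (H →L[ℂ] H) where
  toFun := twirl π σ
  map_add' := twirl_add hπ σ
  map_smul' := twirl_smul hπ σ

omit [CompleteSpace H] [FiniteDimensional ℂ H] in
theorem eq_of_rankOne_basis {ι : Type*} [Fintype ι] (ψ : OrthonormalBasis ι ℂ H)
    {Φ Ψ : (H →L[ℂ] H) →ₗ[ℂ] (H →L[ℂ] H)}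
    (h : ∀ k l, Φ (rankOne ℂ (ψ k) (ψ l)) = Ψ (rankOne ℂ (ψ k) (ψ l))) : Φ = Ψ := by
  refine LinearMap.ext fun A => ?_
  rw [op_eq_sum_rankOne ψ A]
  simp only [map_sum, map_smul, h]

include hπ in
omit [FiniteDimensional ℂ H] in
/-- A basis-free form of the condition `CondM2`. -/
theorem condM2_iff [IsTopologicalGroup G] {ι : Type*} [Fintype ι] [DecidableEq ι]
    (ψ : OrthonormalBasis ι ℂ H) : CondM2 ψ π σ ↔
      (∀ A, Tendsto (fun t => twirl π (σ t) A) (𝓝[>] 0) (𝓝 A)) ∧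
      ∀ s t, 0 < s → 0 < t → ∀ A, twirl π (σ s) (twirl π (σ t) A) = twirl π (σ (s + t)) A := by
  simp only [CondM2, integral_matrixCoeff hπ, twirl_signedConv hπ, ← inner_rankOne_basis ψ]
  constructor
  · rintro ⟨h1, h2⟩
    constructor
    · have h3 : ∀ k l, Tendsto (fun t => twirlₗ hπ (σ t) (rankOne ℂ (ψ k) (ψ l))) (𝓝[>] 0)
          (𝓝 (rankOne ℂ (ψ k) (ψ l))) := fun k l =>
        tendsto_of_inner_basis ψ fun j m => h1 j k l m
      intro A
      change Tendsto (fun t => twirlₗ hπ (σ t) A) _ _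
      rw [op_eq_sum_rankOne ψ A]
      simp only [map_sum, map_smul]
      exact tendsto_finsetSum _ fun j _ => tendsto_finsetSum _ fun k _ => (h3 j k).const_smul _
    · intro s t hs ht A
      have : twirlₗ hπ (σ s) ∘ₗ twirlₗ hπ (σ t) = twirlₗ hπ (σ (s + t)) :=
        eq_of_rankOne_basis ψ fun k l => ext_inner_basis ψ fun j m => h2 j k l m s t hs ht
      exact LinearMap.congr_fun this A
  · rintro ⟨h1, h2⟩
    exact ⟨fun j k l m => tendsto_inner_apply (h1 _) _ _, fun j k l m s t hs ht => by
      rw [h2 s t hs ht]⟩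

variable {Λ : ℝ≥0 → ((H →L[ℂ] H) →ₗ[ℂ] (H →L[ℂ] H))}

omit [TopologicalSpace G] [SecondCountableTopology G] [BorelSpace G] [FiniteDimensional ℂ H] in
theorem isTwirlingIntegral_iff :
    IsTwirlingIntegral Λ π σ ↔ ∀ t A, Λ t A = twirl π (σ t) A := Iff.rfl

include hπ in
theorem IsTwirlingPair.isUnitalPTPSemigroup [IsTopologicalGroup G]
    (hΛ : IsTwirlingIntegral Λ π σ) (h : IsTwirlingPair π σ) : IsUnitalPTPSemigroup Λ := by
  rw [isTwirlingIntegral_iff] at hΛ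
  obtain ⟨ψ, hψ⟩ := h.m2
  obtain ⟨hlim, hcomp⟩ := (condM2_iff hπ ψ).1 hψ
  have huniv : ∀ t, σ t Set.univ = 1 := fun t => by
    rcases eq_or_ne t 0 with rfl | ht
    · rw [h.m1.1]; simp
    · exact h.m1.2 t (pos_iff_ne_zero.2 ht)
  have h0 : Λ 0 = LinearMap.id := by
    refine LinearMap.ext fun A => ?_
    rw [hΛ, h.m1.1, twirl, VectorMeasure.integral_dirac' (isContBdd_conj hπ A).1.stronglyMeasurable]
    simp
  have hsg : IsOpSemigroup Λ := by
    refine ⟨fun t s => ?_, h0, fun A => ?_⟩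
    · rcases eq_or_ne t 0 with rfl | ht
      · rw [h0, zero_add, LinearMap.id_comp]
      rcases eq_or_ne s 0 with rfl | hs
      · rw [h0, add_zero, LinearMap.comp_id]
      refine LinearMap.ext fun A => ?_
      rw [LinearMap.comp_apply, hΛ, hΛ, hΛ,
        hcomp t s (pos_iff_ne_zero.2 ht) (pos_iff_ne_zero.2 hs)]
    · simpa only [hΛ] using hlim A
  have hstar : ∀ t A, Λ t (star A) = star (Λ t A) := fun t A => by
    rw [hΛ, hΛ, twirl_star hπ]
  have hu : ∀ t, IsUnital (Λ t) := fun t => by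
    rw [IsUnital, hΛ, twirl_one, huniv, one_smul]
  obtain ⟨L, hL⟩ := hsg.exists_generator
  refine ⟨⟨hsg, isPositiveMap_of_generator hsg hstar hu hL fun ψ j k hjk => ?_, fun t A => ?_⟩, hu⟩
  · obtain ⟨l, hl0, hl⟩ := h.m3 ψ j k hjk
    have h1 := tendsto_inner_apply
      (IsOpSemigroup.tendsto_generator_apply hL (rankOne ℂ (ψ k) (ψ k))) (ψ j) (ψ j)
    -- For j ≠ k the identity contributes nothing to this matrix element, so the limit in (M3) is
    -- the matrix element of the generator.
    have h2 : inner ℂ (ψ j) (L (rankOne ℂ (ψ k) (ψ k)) (ψ j)) = (l : ℂ) := by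
      refine tendsto_nhds_unique h1 (hl.congr fun t => ?_)
      rw [integral_matrixCoeff hπ, ← hΛ, _root_.smul_apply, _root_.sub_apply, inner_smul_right,
        inner_sub_right, inner_rankOne_basis, if_neg hjk]
      simp
    rw [h2]
    simpa using hl0
  · rw [hΛ, opTrace_twirl hπ, huniv, one_smul]

include hπ in
theorem IsUnitalPTPSemigroup.isTwirlingPair [IsTopologicalGroup G] [Nontrivial H]
    (hS : IsUnitalPTPSemigroup Λ) (hΛ : IsTwirlingIntegral Λ π σ)
    (h0 : σ 0 = VectorMeasure.dirac 1 1) : IsTwirlingPair π σ := by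
  rw [isTwirlingIntegral_iff] at hΛ
  refine ⟨⟨h0, fun t _ => ?_⟩, ⟨stdOrthonormalBasis ℂ H, (condM2_iff hπ _).2 ⟨fun A => ?_, ?_⟩⟩,
    fun ψ j k hjk => ?_⟩
  · have h1 := hS.unital t
    rw [IsUnital, hΛ, twirl_one] at h1
    have h2 : (σ t Set.univ - 1 : ℝ) • (1 : H →L[ℂ] H) = 0 := by rw [sub_smul, h1, one_smul, sub_self]
    rcases smul_eq_zero.1 h2 with h | h
    · linarith
    · exact absurd h one_ne_zero
  · simpa only [← hΛ] using hS.tendsto A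
  · intro s t _ _ A
    rw [← hΛ, ← hΛ, ← hΛ, ← hS.comp, LinearMap.comp_apply]
  · obtain ⟨L, hL⟩ := hS.toIsOpSemigroup.exists_generator
    have h1 := tendsto_inner_apply
      (IsOpSemigroup.tendsto_generator_apply hL (rankOne ℂ (ψ k) (ψ k))) (ψ j) (ψ j)
    have h2 : ∀ t : ℝ≥0, inner ℂ (ψ j)
        ((((t : ℝ) : ℂ)⁻¹ • (Λ t (rankOne ℂ (ψ k) (ψ k)) - rankOne ℂ (ψ k) (ψ k))) (ψ j)) =
        ((t : ℝ) : ℂ)⁻¹ * ∫ᵛ g, matrixCoeff ψ π j k k j g ∂<•(σ t) := fun t => by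
      rw [integral_matrixCoeff hπ, ← hΛ, _root_.smul_apply, _root_.sub_apply, inner_smul_right,
        inner_sub_right, inner_rankOne_basis, if_neg hjk]
      simp
    simp only [h2] at h1
    -- In the complex order, being nonnegative includes being real, so both properties pass to the
    -- limit.
    open scoped ComplexOrder in
    have h3 : 0 ≤ inner ℂ (ψ j) (L (rankOne ℂ (ψ k) (ψ k)) (ψ j)) := by
      refine ge_of_tendsto' h1 fun t => ?_
      rw [integral_matrixCoeff hπ, ← hΛ, ← Complex.ofReal_inv]
      exact mul_nonneg (Complex.zero_le_real.2 (by positivity))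
        ((hS.positive t _ (isPositive_rankOne_self (ψ k))).inner_nonneg_right _)
    obtain ⟨r, hr0, hr⟩ : ∃ r : ℝ, 0 ≤ r ∧ inner ℂ (ψ j) (L (rankOne ℂ (ψ k) (ψ k)) (ψ j)) = (r : ℂ) :=
      ⟨_, (Complex.nonneg_iff.1 h3).1, Complex.ext rfl (Complex.nonneg_iff.1 h3).2.symm⟩
    exact ⟨r, hr0, hr ▸ h1⟩

open scoped ComplexStarModule in
omit [FiniteDimensional ℂ H] in
/-- A positive unital map preserves adjoints. -/
theorem IsPositiveMap.map_star {Φ : (H →L[ℂ] H) →ₗ[ℂ] (H →L[ℂ] H)} (hpos : IsPositiveMap Φ)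
    (hu : IsUnital Φ) (A : H →L[ℂ] H) : Φ (star A) = star (Φ A) := by
  have hsa : ∀ A, IsSelfAdjoint A → IsSelfAdjoint (Φ A) := by
    intro A hA
    have hn : IsSelfAdjoint ((‖A‖ : ℂ) • (1 : H →L[ℂ] H)) := by
      rw [IsSelfAdjoint, star_smul, star_one, Complex.star_def, Complex.conj_ofReal]
    -- A self-adjoint operator becomes positive after adding ‖A‖ 1, and a unital map leaves this
    -- shift unchanged.
    have h1 : (A + (‖A‖ : ℂ) • 1).IsPositive := by
      refine (ContinuousLinearMap.isPositive_def').2 ⟨hA.add hn, fun x => ?_⟩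
      · have h2 : -(‖A‖ * ‖x‖ ^ 2) ≤ (inner ℂ (A x) x).re := by
          have h3 : ‖(inner ℂ (A x) x : ℂ)‖ ≤ ‖A‖ * ‖x‖ ^ 2 := by
            calc ‖(inner ℂ (A x) x : ℂ)‖ ≤ ‖A x‖ * ‖x‖ := norm_inner_le_norm _ _
              _ ≤ (‖A‖ * ‖x‖) * ‖x‖ := by gcongr; exact A.le_opNorm x
              _ = ‖A‖ * ‖x‖ ^ 2 := by ring
          have := (abs_le.1 ((Complex.abs_re_le_norm _).trans h3)).1
          exact this
        simp only [ContinuousLinearMap.reApplyInnerSelf_apply, _root_.add_apply,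
          _root_.smul_apply, inner_add_left, inner_smul_left, Complex.conj_ofReal,
          RCLike.re_to_complex, Complex.add_re, Complex.re_ofReal_mul,
          show (1 : H →L[ℂ] H) x = x from rfl]
        have h4 : (inner ℂ x x : ℂ).re = ‖x‖ ^ 2 := by
          rw [← RCLike.re_to_complex, inner_self_eq_norm_sq]
        rw [h4]
        linarith
    have h2 := (hpos _ h1).isSelfAdjoint
    rw [map_add, map_smul, show Φ 1 = 1 from hu] at h2
    have h3 := h2.sub hn
    rwa [add_sub_cancel_right] at h3
  have hre := realPart_add_I_smul_imaginaryPart A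
  have e1 := (hsa _ (ℜ A).2).star_eq
  have e2 := (hsa _ (ℑ A).2).star_eq
  rw [← hre]
  simp only [star_add, star_smul, map_add, map_smul, e1, e2, (ℜ A).2.star_eq, (ℑ A).2.star_eq]

include hπ in
/-- If the image of `π` exhausts the unitary operators up to phases, then every unital PTP semigroup
is a twirling integral over `π`, with respect to finitely supported signed measures. -/
theorem IsUnitalPTPSemigroup.exists_twirling [IsTopologicalGroup G]
    (hd : 2 ≤ Module.finrank ℂ H) (hS : IsUnitalPTPSemigroup Λ)
    (hsurj : ∀ U : unitary (H →L[ℂ] H), ∃ g : G, unitaryConj (π g) = unitaryConj U) :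
    ∃ σ : ℝ≥0 → SignedMeasure G, IsTwirlingIntegral Λ π σ ∧ IsTwirlingPair π σ := by
  have : Nontrivial H := (Module.finrank_pos_iff (R := ℂ)).1 (by omega)
  choose r hr using hsurj
  choose s c hsc using fun t => exists_real_combination hd (hS.tracePreserving t) (hS.unital t)
    ((hS.positive t).map_star (hS.unital t))
  -- Time 0 is treated apart: the chosen combination representing the identity map need not be the
  -- Dirac measure required by (M1).
  let σ : ℝ≥0 → SignedMeasure G := fun t => if t = 0 then VectorMeasure.dirac 1 1 else
    ∑ U ∈ s t, c t U • VectorMeasure.dirac (r U) 1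
  have hint : ∀ (A : H →L[ℂ] H) (g : G), twirl π (VectorMeasure.dirac g 1) A = unitaryConj (π g) A :=
    fun A g => by
      rw [twirl, VectorMeasure.integral_dirac' (isContBdd_conj hπ A).1.stronglyMeasurable]
      simp [unitaryConj_apply]
  have hΛ : IsTwirlingIntegral Λ π σ := by
    rw [isTwirlingIntegral_iff]
    intro t A
    rcases eq_or_ne t 0 with rfl | ht
    · simp [σ, hint, hS.zero]
    · simp only [σ, if_neg ht]
      rw [twirl, VectorMeasure.integral_finsetSum_vectorMeasure
        fun U _ => (isContBdd_conj hπ A).integrable _, hsc]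
      refine Finset.sum_congr rfl fun U _ => ?_
      rw [VectorMeasure.integral_smul_vectorMeasure]
      congr 1
      exact ((hint A (r U)).trans (by rw [hr]; rfl)).symm
  exact ⟨σ, hΛ, hS.isTwirlingPair hπ hΛ (by simp [σ])⟩

end Conditions

/-! ### Reduction to SU(d) -/

section SpecialUnitary

instance SU.instIsTopologicalGroup (d : ℕ) : IsTopologicalGroup (SU d) where
  continuous_mul := continuous_mul
  continuous_inv := by
    refine Continuous.subtype_mk ?_ _
    exact continuous_star.comp continuous_subtype_val

instance SU.instLocallyCompactSpace (d : ℕ) : LocallyCompactSpace (SU d) := by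
  have h1 : LocallyCompactSpace (Matrix (Fin d) (Fin d) ℂ) :=
    inferInstanceAs (LocallyCompactSpace (Fin d → Fin d → ℂ))
  have h2 : IsClosed (Matrix.specialUnitaryGroup (Fin d) ℂ : Set (Matrix (Fin d) (Fin d) ℂ)) := by
    have h3 : IsClosed (Matrix.unitaryGroup (Fin d) ℂ : Set (Matrix (Fin d) (Fin d) ℂ)) :=
      isClosed_unitary
    have h4 : IsClosed {A : Matrix (Fin d) (Fin d) ℂ | A.det = 1} :=
      isClosed_eq (continuous_id.matrix_det) continuous_const
    exact h3.inter h4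
  exact h2.isClosedEmbedding_subtypeVal.locallyCompactSpace

instance SU.instSecondCountableTopology (d : ℕ) : SecondCountableTopology (SU d) := by
  have h1 : SecondCountableTopology (Matrix (Fin d) (Fin d) ℂ) :=
    inferInstanceAs (SecondCountableTopology (Fin d → Fin d → ℂ))
  exact IsEmbedding.subtypeVal.secondCountableTopology

variable {H : Type*} [NormedAddCommGroup H] [InnerProductSpace ℂ H] [CompleteSpace H]
  [FiniteDimensional ℂ H]

theorem continuous_definingRep {d : ℕ} (ψ : OrthonormalBasis (Fin d) ℂ H) :
    Continuous (definingRep ψ) := by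
  have h : Continuous (opOfMatrix ψ) :=
    LinearMap.continuous_of_finiteDimensional
      ((opOfMatrix ψ : Matrix (Fin d) (Fin d) ℂ ≃⋆ₐ[ℂ] (H →L[ℂ] H)).toAlgEquiv.toLinearMap)
  exact Continuous.subtype_mk (h.comp continuous_subtype_val) _

omit [FiniteDimensional ℂ H] in
theorem unitaryConj_eq_of_smul {U V : unitary (H →L[ℂ] H)} {c : ℂ} (hc : c * star c = 1)
    (h : (U : H →L[ℂ] H) = c • (V : H →L[ℂ] H)) : unitaryConj U = unitaryConj V := by
  refine LinearMap.ext fun A => ?_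
  rw [unitaryConj_apply, unitaryConj_apply, h, star_smul, smul_mul_assoc, smul_mul_assoc,
    mul_smul_comm, smul_smul, hc, one_smul]

/-- Rescaling by a d-th root of the inverse determinant, which has modulus 1, makes the determinant
1 and leaves the conjugation unchanged. -/
theorem exists_definingRep_unitaryConj {d : ℕ} (hd : d ≠ 0) (ψ : OrthonormalBasis (Fin d) ℂ H)
    (U : unitary (H →L[ℂ] H)) : ∃ g : SU d, unitaryConj (definingRep ψ g) = unitaryConj U := by
  let M : Matrix (Fin d) (Fin d) ℂ := (opOfMatrix ψ).symm U
  have hM : M ∈ Matrix.unitaryGroup (Fin d) ℂ := Unitary.map_mem (opOfMatrix ψ).symm U.2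
  have hdet : M.det * star M.det = 1 :=
    Unitary.mul_star_self_of_mem (Matrix.det_of_mem_unitary hM)
  have hdet0 : M.det ≠ 0 := left_ne_zero_of_mul_eq_one hdet
  obtain ⟨z, hz⟩ := IsAlgClosed.exists_pow_nat_eq (M.det)⁻¹ (Nat.pos_of_ne_zero hd)
  have hz1 : ‖z‖ = 1 := by
    have h1 : ‖M.det‖ ^ 2 = 1 := by
      have := congrArg norm hdet
      rw [norm_mul, norm_star, norm_one] at this
      rw [sq, this]
    have h2 : ‖M.det‖ = 1 := (pow_eq_one_iff_of_nonneg (norm_nonneg _) two_ne_zero).1 h1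
    have h3 : ‖z‖ ^ d = 1 := by rw [← norm_pow, hz, norm_inv, h2, inv_one]
    exact (pow_eq_one_iff_of_nonneg (norm_nonneg _) hd).1 h3
  have hzz : z * star z = 1 := by
    rw [Complex.star_def, Complex.mul_conj, Complex.normSq_eq_norm_sq, hz1]
    simp
  have hzM : z • M ∈ Matrix.specialUnitaryGroup (Fin d) ℂ := by
    rw [Matrix.mem_specialUnitaryGroup_iff]
    constructor
    · rw [Matrix.mem_unitaryGroup_iff, star_smul, smul_mul_assoc, mul_smul_comm, smul_smul, hzz,
        one_smul]
      exact Matrix.mem_unitaryGroup_iff.1 hM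
    · rw [Matrix.det_smul, Fintype.card_fin, hz, inv_mul_cancel₀ hdet0]
  refine ⟨⟨z • M, hzM⟩, unitaryConj_eq_of_smul hzz ?_⟩
  change opOfMatrix ψ (z • M) = _
  rw [map_smul]
  simp [M]

variable {Λ : ℝ≥0 → ((H →L[ℂ] H) →ₗ[ℂ] (H →L[ℂ] H))}

theorem IsUnitalPTPSemigroup.exists_twirling_SU (hd : 2 ≤ Module.finrank ℂ H)
    (hS : IsUnitalPTPSemigroup Λ) (ψ : OrthonormalBasis (Fin (Module.finrank ℂ H)) ℂ H) :
    ∃ σ : ℝ≥0 → SignedMeasure (SU (Module.finrank ℂ H)),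
      IsTwirlingIntegral Λ (definingRep ψ) σ ∧ IsTwirlingPair (definingRep ψ) σ :=
  hS.exists_twirling (continuous_definingRep ψ) hd
    (exists_definingRep_unitaryConj (by omega) ψ)

theorem isUnitalPTPSemigroup_iff (hd : 2 ≤ Module.finrank ℂ H) :
    IsUnitalPTPSemigroup Λ ↔ IsGeneralizedTwirling.{u} Λ := by
  constructor
  · intro hS
    let ψ := stdOrthonormalBasis ℂ H
    -- The lift only moves SU(d) into the universe over which the group is quantified.
    let π : ULift.{u} (SU (Module.finrank ℂ H)) →* unitary (H →L[ℂ] H) :=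
      (definingRep ψ).comp MulEquiv.ulift.toMonoidHom
    have hπ : Continuous π := (continuous_definingRep ψ).comp continuous_uliftDown
    have : SecondCountableTopology (ULift.{u} (SU (Module.finrank ℂ H))) :=
      IsEmbedding.uliftDown.secondCountableTopology
    have : LocallyCompactSpace (ULift.{u} (SU (Module.finrank ℂ H))) :=
      IsClosedEmbedding.uliftDown.locallyCompactSpace
    obtain ⟨σ, h1, h2⟩ := hS.exists_twirling hπ hd fun U =>
      let ⟨g, hg⟩ := exists_definingRep_unitaryConj (by omega) ψ U
      ⟨ULift.up g, hg⟩
    exact ⟨_, inferInstance, inferInstance, inferInstance, inferInstance, inferInstance,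
      inferInstance, inferInstance, inferInstance, π, σ, hπ, h1, h2⟩
  · rintro ⟨G, _, _, _, _, _, _, _, _, π, σ, hπ, h1, h2⟩
    exact h2.isUnitalPTPSemigroup hπ h1

omit [FiniteDimensional ℂ H] in
theorem IsGeneralizedTwirling.hasTwirlingForm (h : IsGeneralizedTwirling.{u} Λ) :
    HasTwirlingForm.{u} Λ := by
  obtain ⟨G, i1, i2, i3, i4, i5, i6, i7, i8, π, σ, hπ, h1, _⟩ := h
  exact ⟨G, i1, i2, i3, i4, i5, i6, i7, i8, π, σ, hπ, h1⟩

/-- The integral sends 1 to σ_t(G) 1; comparing traces gives σ_t(G) d = d. -/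
theorem HasTwirlingForm.isUnital (hd : 2 ≤ Module.finrank ℂ H) (h : HasTwirlingForm.{u} Λ)
    (hΛ : IsPTPSemigroup Λ) (t : ℝ≥0) : IsUnital (Λ t) := by
  obtain ⟨G, _, _, _, _, _, _, _, _, π, σ, hπ, h1⟩ := h
  have h2 : Λ t 1 = (σ t Set.univ : ℂ) • 1 := by
    rw [Complex.coe_smul]
    exact (h1 t 1).trans (twirl_one _)
  have h3 := hΛ.tracePreserving t 1
  rw [h2, opTrace_smul, opTrace_one] at h3
  have h4 : (Module.finrank ℂ H : ℂ) ≠ 0 := Nat.cast_ne_zero.2 (by omega)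
  rw [IsUnital, h2, (mul_eq_right₀ h4).1 h3, one_smul]

end SpecialUnitary

end GenTwirling

/-! ### The main theorem -/

theorem mainTheorem3 {H : Type v} [NormedAddCommGroup H] [InnerProductSpace ℂ H]
    [CompleteSpace H] [FiniteDimensional ℂ H] (hd : 2 ≤ Module.finrank ℂ H)
    (Λ : ℝ≥0 → ((H →L[ℂ] H) →ₗ[ℂ] (H →L[ℂ] H))) :
    -- the unital PTP semigroups are precisely the generalized twirling semigroups
    (IsUnitalPTPSemigroup Λ ↔ IsGeneralizedTwirling.{u} Λ) ∧
    -- `G = SU(d)` and the defining representation are always enough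
    (IsUnitalPTPSemigroup Λ → ∀ ψ : OrthonormalBasis (Fin (Module.finrank ℂ H)) ℂ H,
      Continuous (definingRep ψ) ∧
      ∃ σ : ℝ≥0 → SignedMeasure (SU (Module.finrank ℂ H)),
        IsTwirlingIntegral Λ (definingRep ψ) σ ∧ IsTwirlingPair (definingRep ψ) σ) ∧
    -- `CondM2` holds for every orthonormal basis as soon as it holds for some orthonormal basis
    (∀ (G : Type u) [Group G] [TopologicalSpace G] [IsTopologicalGroup G] [LocallyCompactSpace G]
      [SecondCountableTopology G] [T2Space G] [MeasurableSpace G] [BorelSpace G]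
      (π : G →* unitary (H →L[ℂ] H)) (σ : ℝ≥0 → SignedMeasure G), Continuous π →
      (∃ ψ : OrthonormalBasis (Fin (Module.finrank ℂ H)) ℂ H, CondM2 ψ π σ) →
      ∀ ψ : OrthonormalBasis (Fin (Module.finrank ℂ H)) ℂ H, CondM2 ψ π σ) ∧
    -- entropy non-decreasing PTP semigroups
    (∀ (hΛ : IsPTPSemigroup Λ) (E : DensityOp H → ℝ), IsQuantumEntropy E →
      (DoesNotDecrease hΛ E ↔ HasTwirlingForm.{u} Λ) ∧
      (DoesNotDecrease hΛ E ↔ IsGeneralizedTwirling.{u} Λ)) := by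
  refine ⟨isUnitalPTPSemigroup_iff hd,
    fun hS ψ => ⟨continuous_definingRep ψ, hS.exists_twirling_SU hd ψ⟩, ?_, fun hΛ E hE => ?_⟩
  · rintro G _ _ _ _ _ _ _ _ π σ hπ ⟨ψ, hψ⟩ ψ'
    exact (condM2_iff hπ ψ').2 ((condM2_iff hπ ψ).1 hψ)
  · have h1 : DoesNotDecrease hΛ E → IsGeneralizedTwirling.{u} Λ := fun h =>
      (isUnitalPTPSemigroup_iff hd).1 ⟨hΛ, (hE.doesNotDecrease_iff hd hΛ).1 h⟩
    have h2 : HasTwirlingForm.{u} Λ → DoesNotDecrease hΛ E := fun h =>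
      (hE.doesNotDecrease_iff hd hΛ).2 (h.isUnital hd hΛ)
    exact ⟨⟨fun h => (h1 h).hasTwirlingForm, h2⟩, ⟨h1, fun h => h2 h.hasTwirlingForm⟩⟩
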